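/- Let $d\ge 1$. For a finite set $\Omega\subset\mathbb{Z}^d$ write $N_\Omega$ for its cardinality and $\mathrm{diam}(\Omega)=\max\{|k-j|_2:k,j\in\Omega\}$ for its Euclidean diameter. Consider the class of all stationary, real, zero mean Gaussian processes $X=(X_n)_{n\in\mathbb{Z}^d}$, with covariances $\sigma_{n-m}=\mathbb{E}\{X_nX_m\}$, whose spectral density $$S(\xi)=\sum_{n\in\mathbb{Z}^d}\sigma_n e^{2\pi i\langle \xi,n\rangle},\qquad \xi\in\mathbb{R}^d$$ (the series converging unconditionally at every $\xi$), is twice continuously differentiable with $$\|S\|_{C^2}=\max\Big\{\max_{\xi}|S(\xi)|,\ \max_{\xi}|\partial_{\xi_j}S(\xi)|,\ \max_{\xi}|\partial_{\xi_j}\partial_{\xi_k}S(\xi)| : j,k=1,\dots,d\Big\}\le 1 .$$ An estimator $\widehat S$ based on an observation of $X$ on $\Omega$ is a map assigning to the observed values $(X_k)_{k\in\Omega}$ a function $\widehat S:\mathbb{R}^d\to\mathbb{R}$ such that $\widehat S(\xi)$ is a measurable function of these values for every $\xi$; put $\|f\|_\infty=\sup_{\xi\in\mathbb{R}^d}|f(\xi)|$.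 There is a constant $c>0$, depending only on $d$, such that for every finite $\Omega\subset\mathbb{Z}^d$ with $N_\Omega\ge 3$ $$\inf_{\widehat S}\ \sup_{S}\ \mathbb{E}\big\{\|S-\widehat S\|_\infty^2\big\}\ \ge\ c\left(\frac{\log N_\Omega}{\mathrm{diam}(\Omega)^d}\right)^{\frac{4}{4+d}},$$ where the supremum is over all processes of the above class and the infimum over all estimators based on an observation of $X$ on $\Omega$. In particular, for every $C>0$ there is a constant $c>0$, depending only on $d$ and $C$, such that for every finite $\Omega\subset\mathbb{Z}^d$ with $N_\Omega\ge 3$ and $\mathrm{diam}(\Omega)\le C\,N_\Omega^{1/d}$ $$\inf_{\widehat S}\ \sup_{S}\ \mathbb{E}\big\{\|S-\widehat S\|_\infty^2\big\}\ \ge\ c\left(\frac{\log N_\Omega}{N_\Omega}\right)^{\frac{4}{4+d}} .$$ -/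

import Mathlib

open MeasureTheory ProbabilityTheory
open scoped ENNReal

noncomputable section

namespace SpectralEstimation

/-- The integer grid in dimension `d`. -/
abbrev Grid (d : ℕ) : Type := Fin d → ℤ

/-- Euclidean diameter `max {|k - j|₂ : k, j ∈ Ω}` of a finite set of grid points. -/
def euclideanDiam {d : ℕ} (Ω : Finset (Grid d)) : ℝ :=
  Metric.diam ((fun k : Grid d => (WithLp.toLp 2 (fun i => (k i : ℝ)) : EuclideanSpace ℝ (Fin d))) ''
    (Ω : Set (Grid d)))

/-- The partial derivative `∂_j S` in the `j`-th coordinate. -/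
def partialDeriv {d : ℕ} (j : Fin d) (S : (Fin d → ℝ) → ℝ) (ξ : Fin d → ℝ) : ℝ :=
  fderiv ℝ S ξ (Pi.single j 1)

/-- The uniform norm, with value `∞` for unbounded functions. -/
def uniformNorm {d : ℕ} (f : (Fin d → ℝ) → ℝ) : ℝ≥0∞ := ⨆ ξ, ENNReal.ofReal |f ξ|

/-- The `C²` norm: the maximum of the uniform norms of `S` and of its partial derivatives of
order one and two. It is used only for functions that are twice continuously differentiable. -/
def c2Norm {d : ℕ} (S : (Fin d → ℝ) → ℝ) : ℝ≥0∞ :=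
  uniformNorm S ⊔ (⨆ j, uniformNorm (partialDeriv j S)) ⊔
    (⨆ j, ⨆ k, uniformNorm (partialDeriv j (partialDeriv k S)))

/-- `P` is the law, on the path space `ℝ ^ (ℤ ^ d)`, of a stationary, real, zero mean Gaussian
process. For such processes strict stationarity and invariance of the covariance under shifts
are the same. -/
structure IsStationaryGaussian {d : ℕ} (P : Measure (Grid d → ℝ)) : Prop where
  gaussian : IsGaussianProcess (fun (n : Grid d) (x : Grid d → ℝ) => x n) P
  mean_zero : ∀ n, ∫ x, x n ∂P = 0
  stationary : ∀ n m k, ∫ x, x (n + k) * x (m + k) ∂P = ∫ x, x n * x m ∂P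

/-- The autocovariance `σ_n = 𝔼 (X_n X_0)`, so that `𝔼 (X_n X_m) = σ_{n-m}`. -/
def autocov {d : ℕ} (P : Measure (Grid d → ℝ)) (n : Grid d) : ℝ := ∫ x, x n * x 0 ∂P

/-- `S` is the spectral density of `P`: `S(ξ) = ∑_{n ∈ ℤ^d} σ_n exp(2πi⟨ξ, n⟩)` for all `ξ`. -/
def HasSpectralDensity {d : ℕ} (P : Measure (Grid d → ℝ)) (S : (Fin d → ℝ) → ℝ) : Prop :=
  ∀ ξ : Fin d → ℝ, HasSum
    (fun n : Grid d => (autocov P n : ℂ) *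
      Complex.exp (2 * (Real.pi : ℂ) * Complex.I * ((∑ i, ξ i * (n i : ℝ) : ℝ) : ℂ)))
    (S ξ : ℂ)

/-- `P` is the law of a stationary, real, zero mean Gaussian process on `ℤ^d` whose spectral
density `S` is twice continuously differentiable with `‖S‖_{C²} ≤ 1`. -/
structure IsAdmissible {d : ℕ} (P : Measure (Grid d → ℝ)) (S : (Fin d → ℝ) → ℝ) : Prop where
  process : IsStationaryGaussian P
  density : HasSpectralDensity P S
  contDiff : ContDiff ℝ 2 S
  norm_le : c2Norm S ≤ 1

/-- An estimator based on an observation on `Ω`: a function of the observed values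
`(X_k)_{k ∈ Ω}` with values in the functions on `ℝ^d`, measurable at each frequency. -/
structure Estimator {d : ℕ} (Ω : Finset (Grid d)) where
  toFun : (Ω → ℝ) → (Fin d → ℝ) → ℝ
  measurable_eval : ∀ ξ, Measurable fun y => toFun y ξ

/-- The risk `𝔼 ‖S - Ŝ‖_∞²` of an estimator when the process has law `P`. -/
def risk {d : ℕ} {Ω : Finset (Grid d)} (E : Estimator Ω) (P : Measure (Grid d → ℝ))
    (S : (Fin d → ℝ) → ℝ) : ℝ≥0∞ :=
  ∫⁻ x, uniformNorm (fun ξ => S ξ - E.toFun (fun k => x k.1) ξ) ^ 2 ∂P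

/-- The minimax risk `inf_Ŝ sup_S 𝔼 ‖S - Ŝ‖_∞²` for observations on `Ω`. -/
def minimaxRisk {d : ℕ} (Ω : Finset (Grid d)) : ℝ≥0∞ :=
  ⨅ E : Estimator Ω, ⨆ (P : Measure (Grid d → ℝ)) (S : (Fin d → ℝ) → ℝ) (_ : IsAdmissible P S),
    risk E P S

end SpectralEstimation

end

/-! The bound comes from testing many hypotheses. Each hypothesis is a moving average of white noise
whose transfer function is 1/2 plus a trigonometric polynomial of degree less than m = 2p+1 in each
variable, with coefficients of size at most a/(m²·m^d), peaking at one of p^d grid frequencies. Two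
derivatives cost a factor of order m², so the spectral density stays in the C² unit ball
(`isAdmissible_bump`). Orthogonality of cosines makes the density exactly 1/4 at every other grid
frequency and at least 1/4 plus a multiple of m⁻² at its own (`density_gridFreq_of_ne`,
`density_gridFreq_self`). Working with moving averages makes Gaussianity, stationarity and the
spectral density explicit.

On N sites the covariance matrix is (1 + T)/4, where T has small row sums and squared Frobenius norm
of order at most N/m^(4+d) (`sum_sq_covExcess_le`). An orthogonal change of variables diagonalizing
T turns both this law and white noise of variance 1/4 into product laws. The second moment of their
likelihood ratio is then at most exp(‖T‖²), and Cauchy–Schwarz gives P(A)² ≤ exp(‖T‖²) ν(A)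
(`sq_map_le_of_covariance`), with ν the white noise law.

For any estimator, the events "the error at all grid frequencies is below half the separation", one
for each hypothesis, are disjoint, so one of them has ν-probability at most p^(-d). If exp(‖T‖²) ≤
p^d/4, that event has probability at most 1/2 under its own hypothesis, and the risk there is at
least of the order of the squared separation, m⁻⁴ (`le_minimaxRisk_of_separated`).

With m of order (N/log N)^(1/(4+d)) the exponent ‖T‖² is a small multiple of log N, so the condition
holds and m⁻⁴ is the rate in N (`le_minimaxRisk`). The rate in the diameter follows from N ≤ (3
diam)^d (`card_le_euclideanDiam_pow`). -/

namespace SpectralEstimation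

open scoped NNReal Matrix

/-! ### Second-moment comparison of product Gaussian laws -/

/-- Density of a product of measures given by densities. -/
theorem pi_withDensity {ι : Type*} [Fintype ι] {E : ι → Type*} [∀ i, MeasurableSpace (E i)]
    (μ : ∀ i, Measure (E i)) [∀ i, IsProbabilityMeasure (μ i)] (f : ∀ i, E i → ℝ≥0∞)
    (hf : ∀ i, Measurable (f i)) [∀ i, SigmaFinite ((μ i).withDensity (f i))] :
    Measure.pi (fun i => (μ i).withDensity (f i)) =
      (Measure.pi μ).withDensity (fun x => ∏ i, f i (x i)) := by
  refine Measure.pi_eq fun s hs => ?_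
  have hm : MeasurableSet (Set.univ.pi s) := MeasurableSet.univ_pi hs
  rw [withDensity_apply _ hm, ← lintegral_indicator hm]
  have h1 : ∀ x : (∀ i, E i), (Set.univ.pi s).indicator (fun x => ∏ i, f i (x i)) x =
      ∏ i, (s i).indicator (f i) (x i) := by
    intro x
    by_cases hx : x ∈ Set.univ.pi s
    · rw [Set.indicator_of_mem hx]
      refine Finset.prod_congr rfl fun i _ => ?_
      rw [Set.indicator_of_mem (hx i trivial)]
    · rw [Set.indicator_of_notMem hx]
      simp only [Set.mem_univ_pi, not_forall] at hx
      obtain ⟨i, hi⟩ := hx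
      rw [Finset.prod_eq_zero (Finset.mem_univ i)]
      rw [Set.indicator_of_notMem hi]
  simp_rw [h1]
  have hmeas : ∀ i, Measurable ((s i).indicator (f i)) := fun i => (hf i).indicator (hs i)
  have hind : iIndepFun (fun i (x : ∀ i, E i) => (s i).indicator (f i) (x i)) (Measure.pi μ) :=
    iIndepFun_pi fun i => (hmeas i).aemeasurable
  rw [lintegral_prod_eq_prod_lintegral_of_indepFun Finset.univ _ hind
    (fun i => (hmeas i).comp (measurable_pi_apply i))]
  refine Finset.prod_congr rfl fun i _ => ?_
  rw [withDensity_apply _ (hs i), ← lintegral_indicator (hs i)]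
  exact (measurePreserving_eval μ i).lintegral_comp (hmeas i)

/-- The integral of a product of functions of independent coordinates. -/
theorem lintegral_pi_prod {ι : Type*} [Fintype ι] {E : ι → Type*} [∀ i, MeasurableSpace (E i)]
    (μ : ∀ i, Measure (E i)) [∀ i, IsProbabilityMeasure (μ i)] (f : ∀ i, E i → ℝ≥0∞)
    (hf : ∀ i, Measurable (f i)) :
    ∫⁻ x, ∏ i, f i (x i) ∂(Measure.pi μ) = ∏ i, ∫⁻ x, f i x ∂(μ i) := by
  have hind : iIndepFun (fun i (x : ∀ i, E i) => f i (x i)) (Measure.pi μ) :=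
    iIndepFun_pi fun i => (hf i).aemeasurable
  rw [lintegral_prod_eq_prod_lintegral_of_indepFun Finset.univ _ hind
    (fun i => (hf i).comp (measurable_pi_apply i))]
  exact Finset.prod_congr rfl fun i _ => (measurePreserving_eval μ i).lintegral_comp (hf i)

/-- Cauchy–Schwarz bound for the probability of an event under a change of measure. -/
theorem sq_withDensity_le {α : Type*} [MeasurableSpace α] (μ : Measure α) {f : α → ℝ≥0∞}
    (hf : Measurable f) {A : Set α} (hA : MeasurableSet A) :
    (μ.withDensity f A) ^ 2 ≤ (∫⁻ x, f x ^ 2 ∂μ) * μ A := by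
  rw [withDensity_apply _ hA, ← lintegral_indicator hA]
  have h := ENNReal.lintegral_mul_le_Lp_mul_Lq μ Real.HolderConjugate.two_two hf.aemeasurable
    (measurable_one.indicator hA : Measurable (A.indicator (1 : α → ℝ≥0∞))).aemeasurable
  have e1 : ∫⁻ x, (f * A.indicator (1 : α → ℝ≥0∞)) x ∂μ = ∫⁻ x, A.indicator f x ∂μ := by
    refine lintegral_congr fun x => ?_
    by_cases hx : x ∈ A <;> simp [hx]
  have e2 : ∫⁻ x, A.indicator (1 : α → ℝ≥0∞) x ^ (2 : ℝ) ∂μ = μ A := by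
    rw [← lintegral_indicator_one hA]
    refine lintegral_congr fun x => ?_
    by_cases hx : x ∈ A <;> simp [hx]
  rw [e1, e2] at h
  refine (pow_le_pow_left' h 2).trans ?_
  rw [mul_pow, ← ENNReal.rpow_natCast, ← ENNReal.rpow_natCast, ← ENNReal.rpow_mul,
    ← ENNReal.rpow_mul]
  simp

/-- The exponents combine to -x²(2 - v)/(2v), which is again Gaussian precisely when v < 2; the
prefactor is then the second moment of the likelihood ratio. -/
theorem gaussianPDFReal_sq_div {v w : ℝ≥0} (hv : 0 < v) (hw : (w : ℝ) = v / (2 - v))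
    (hv2 : (v : ℝ) < 2) (x : ℝ) :
    gaussianPDFReal 0 1 x * (gaussianPDFReal 0 v x / gaussianPDFReal 0 1 x) ^ 2 =
      (√(v * (2 - v)))⁻¹ * gaussianPDFReal 0 w x := by
  have hv0 : (0 : ℝ) < v := hv
  have h2 : (0 : ℝ) < 2 - v := by linarith
  have hp : (0 : ℝ) < 2 * Real.pi := by positivity
  simp only [gaussianPDFReal, NNReal.coe_one, sub_zero, mul_one]
  have hs1 : √(2 * Real.pi * v) = √(2 * Real.pi) * √v := Real.sqrt_mul hp.le _
  have hs2 : √(2 * Real.pi * w) = √(2 * Real.pi) * (√v / √(2 - v)) := by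
    rw [Real.sqrt_mul hp.le, hw, Real.sqrt_div hv0.le]
  have hs3 : √((v : ℝ) * (2 - v)) = √v * √(2 - v) := Real.sqrt_mul hv0.le _
  rw [hs1, hs2, hs3]
  have hexp : Real.exp (-x ^ 2 / (2 * (w : ℝ))) =
      Real.exp (-x ^ 2 / (2 * v)) ^ 2 / Real.exp (-x ^ 2 / 2) := by
    rw [← Real.exp_nat_mul, ← Real.exp_sub, hw]
    congr 1
    field_simp
    push_cast
    ring
  rw [hexp]
  have q1 : 0 < √(2 * Real.pi) := Real.sqrt_pos.2 hp
  have q2 : 0 < √(v : ℝ) := Real.sqrt_pos.2 hv0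
  have q3 : 0 < √(2 - (v : ℝ)) := Real.sqrt_pos.2 h2
  have q4 := Real.exp_pos (-x ^ 2 / 2)
  field_simp

/-- The linear terms cancel in (1 + t)(1 - t) = 1 - t², so the exponent is quadratic in t and its
sum becomes a Frobenius norm. The inequality reduces to (1 - t²)(1 + 2t²) ≥ 1. -/
theorem inv_sqrt_le_exp_sq {t : ℝ} (ht : |t| ≤ 1 / 2) :
    (√((1 + t) * (2 - (1 + t))))⁻¹ ≤ Real.exp (t ^ 2) := by
  have ht2 : t ^ 2 ≤ 1 / 4 := by
    have := abs_le.1 ht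
    nlinarith
  have h0 : 0 ≤ t ^ 2 := sq_nonneg t
  rw [← inv_inv (Real.exp (t ^ 2)), ← Real.exp_neg]
  refine inv_anti₀ (Real.exp_pos _) (Real.le_sqrt_of_sq_le ?_)
  rw [← Real.exp_nat_mul, show ((2 : ℕ) : ℝ) * -t ^ 2 = -(2 * t ^ 2) by push_cast; ring, Real.exp_neg]
  have h1 := Real.add_one_le_exp (2 * t ^ 2)
  have h2 : (Real.exp (2 * t ^ 2))⁻¹ ≤ (2 * t ^ 2 + 1)⁻¹ := inv_anti₀ (by positivity) h1
  refine h2.trans ?_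
  rw [inv_le_iff_one_le_mul₀ (by positivity)]
  nlinarith

/-- The second moment of the density of `N(0, v)` with respect to the standard normal law. -/
theorem lintegral_gaussianPDF_div_sq_le {v : ℝ≥0} (hv : |(v : ℝ) - 1| ≤ 1 / 2) :
    ∫⁻ x, (ENNReal.ofReal (gaussianPDFReal 0 v x / gaussianPDFReal 0 1 x)) ^ 2 ∂(gaussianReal 0 1)
      ≤ ENNReal.ofReal (Real.exp (((v : ℝ) - 1) ^ 2)) := by
  have hv' := abs_le.1 hv
  have hv0 : (0 : ℝ) < v := by linarith
  have hv2 : (v : ℝ) < 2 := by linarith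
  set w : ℝ≥0 := ⟨v / (2 - v), div_nonneg hv0.le (by linarith)⟩ with hwdef
  have hw : (w : ℝ) = v / (2 - v) := rfl
  have hw0 : w ≠ 0 := by
    intro h
    have : (w : ℝ) ≠ 0 := by rw [hw]; exact (div_pos hv0 (by linarith)).ne'
    exact this (by rw [h]; rfl)
  have hm : Measurable fun x => gaussianPDFReal 0 v x / gaussianPDFReal 0 1 x :=
    (measurable_gaussianPDFReal _ _).div (measurable_gaussianPDFReal _ _)
  rw [gaussianReal_of_var_ne_zero _ one_ne_zero,
    lintegral_withDensity_eq_lintegral_mul _ (measurable_gaussianPDF _ _)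
      (hm.ennreal_ofReal.pow_const 2)]
  have e : ∀ x, (gaussianPDF 0 1 * fun x =>
      (ENNReal.ofReal (gaussianPDFReal 0 v x / gaussianPDFReal 0 1 x)) ^ 2) x =
      ENNReal.ofReal (√(v * (2 - v)))⁻¹ * gaussianPDF 0 w x := by
    intro x
    have hq : 0 ≤ gaussianPDFReal 0 v x / gaussianPDFReal 0 1 x :=
      div_nonneg (gaussianPDFReal_nonneg _ _ _) (gaussianPDFReal_nonneg _ _ _)
    simp only [Pi.mul_apply, gaussianPDF]
    rw [← ENNReal.ofReal_pow hq, ← ENNReal.ofReal_mul (gaussianPDFReal_nonneg _ _ _),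
      gaussianPDFReal_sq_div hv0 hw hv2, ENNReal.ofReal_mul (by positivity)]
  rw [lintegral_congr e, lintegral_const_mul _ (measurable_gaussianPDF _ _),
    lintegral_gaussianPDF_eq_one _ hw0, mul_one]
  refine ENNReal.ofReal_le_ofReal ?_
  have := inv_sqrt_le_exp_sq hv
  rwa [add_sub_cancel] at this

theorem gaussianReal_eq_withDensity {v : ℝ≥0} (hv : v ≠ 0) :
    gaussianReal 0 v = (gaussianReal 0 1).withDensity
      (fun x => ENNReal.ofReal (gaussianPDFReal 0 v x / gaussianPDFReal 0 1 x)) := by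
  have hm : Measurable fun x => gaussianPDFReal 0 v x / gaussianPDFReal 0 1 x :=
    (measurable_gaussianPDFReal _ _).div (measurable_gaussianPDFReal _ _)
  rw [gaussianReal_of_var_ne_zero _ one_ne_zero, gaussianReal_of_var_ne_zero _ hv,
    ← withDensity_mul _ (measurable_gaussianPDF _ _) hm.ennreal_ofReal]
  congr 1
  ext x
  simp only [Pi.mul_apply, gaussianPDF]
  rw [← ENNReal.ofReal_mul (gaussianPDFReal_nonneg _ _ _),
    mul_div_cancel₀ _ (gaussianPDFReal_pos _ _ _ one_ne_zero).ne']

/-- Comparison of a centred product Gaussian law with the standard one. -/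
theorem sq_pi_gaussianReal_le {ι : Type*} [Fintype ι] (v : ι → ℝ≥0)
    (hv : ∀ i, |(v i : ℝ) - 1| ≤ 1 / 2) {A : Set (ι → ℝ)} (hA : MeasurableSet A) :
    (Measure.pi (fun i => gaussianReal 0 (v i)) A) ^ 2 ≤
      ENNReal.ofReal (Real.exp (∑ i, ((v i : ℝ) - 1) ^ 2)) *
        Measure.pi (fun _ : ι => gaussianReal 0 1) A := by
  have hv0 : ∀ i, v i ≠ 0 := by
    intro i h
    have := hv i
    rw [h] at this
    norm_num at this
  let f : ι → ℝ → ℝ≥0∞ := fun i x =>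
    ENNReal.ofReal (gaussianPDFReal 0 (v i) x / gaussianPDFReal 0 1 x)
  have hf : ∀ i, Measurable (f i) := fun i =>
    ((measurable_gaussianPDFReal _ _).div (measurable_gaussianPDFReal _ _)).ennreal_ofReal
  have e : ∀ i, gaussianReal 0 (v i) = (gaussianReal 0 1).withDensity (f i) := fun i =>
    gaussianReal_eq_withDensity (hv0 i)
  have : ∀ i, SigmaFinite ((gaussianReal 0 1).withDensity (f i)) := by
    intro i
    rw [← e i]
    infer_instance
  have h1 : Measure.pi (fun i => gaussianReal 0 (v i)) =
      (Measure.pi (fun _ : ι => gaussianReal 0 1)).withDensity (fun x => ∏ i, f i (x i)) := by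
    rw [← pi_withDensity _ f hf]
    congr 1
    ext1 i
    exact e i
  have hF : Measurable fun x : ι → ℝ => ∏ i, f i (x i) :=
    Finset.measurable_prod _ fun i _ => (hf i).comp (measurable_pi_apply i)
  rw [h1]
  refine (sq_withDensity_le _ hF hA).trans ?_
  gcongr
  simp_rw [← Finset.prod_pow]
  rw [lintegral_pi_prod (fun _ : ι => gaussianReal 0 1) (fun i x => f i x ^ 2)
    fun i => (hf i).pow_const 2, Real.exp_sum, ENNReal.ofReal_prod_of_nonneg
      fun i _ => (Real.exp_pos _).le]
  exact Finset.prod_le_prod' fun i _ => lintegral_gaussianPDF_div_sq_le (hv i)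

/-- A centred Gaussian vector with uncorrelated components has a product law. -/
theorem map_eq_pi_gaussianReal {ι W : Type*} [Fintype ι] [DecidableEq ι] {mW : MeasurableSpace W}
    {P : Measure W} {X : ι → W → ℝ} (hX : HasGaussianLaw (fun ω => (X · ω)) P)
    (h0 : ∀ i, ∫ ω, X i ω ∂P = 0) (v : ι → ℝ≥0)
    (hc : ∀ i j, ∫ ω, X i ω * X j ω ∂P = if i = j then (v i : ℝ) else 0) :
    P.map (fun ω i => X i ω) = Measure.pi (fun i => gaussianReal 0 (v i)) := by
  have := hX.isProbabilityMeasure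
  have hL2 : ∀ i, MemLp (X i) 2 P := fun i => (hX.eval i).memLp_two
  have hind : iIndepFun X P := by
    refine hX.iIndepFun_of_covariance_eq_zero fun i j hij => ?_
    rw [covariance_eq_sub (hL2 i) (hL2 j)]
    simp [h0, hc, hij]
  rw [(iIndepFun_iff_map_fun_eq_pi_map fun i => (hX.eval i).aemeasurable).1 hind]
  congr 1
  ext1 i
  rw [(hX.eval i).map_eq_gaussianReal, h0, variance_of_integral_eq_zero
    (hX.eval i).aemeasurable (h0 i)]
  congr 1
  have : ∫ ω, X i ω ^ 2 ∂P = v i := by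
    simpa [sq] using hc i i
  rw [this, Real.toNNReal_coe]

end SpectralEstimation

/-! ### Gaussian vectors with covariance close to the identity -/

namespace SpectralEstimation

open scoped NNReal Matrix

/-- An orthogonal matrix diagonalizing the covariance maps a centred Gaussian vector to a vector
with independent components. -/
theorem map_apply_eq_pi_of_orthogonal {ι W : Type*} [Fintype ι] [DecidableEq ι]
    {mW : MeasurableSpace W} {P : Measure W} {X : ι → W → ℝ}
    (hX : HasGaussianLaw (fun ω => (X · ω)) P) (h0 : ∀ i, ∫ ω, X i ω ∂P = 0)
    (C U : Matrix ι ι ℝ) (hc : ∀ i j, ∫ ω, X i ω * X j ω ∂P = C i j)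
    (hU : U * Uᵀ = 1) (v : ι → ℝ≥0) (hD : Uᵀ * C * U = Matrix.diagonal fun i => (v i : ℝ))
    {A : Set (ι → ℝ)} (hA : MeasurableSet A) :
    P.map (fun ω i => X i ω) A =
      Measure.pi (fun i => gaussianReal 0 (v i)) {y | U *ᵥ y ∈ A} := by
  have := hX.isProbabilityMeasure
  let Y : ι → W → ℝ := fun k ω => (Uᵀ *ᵥ (fun i => X i ω)) k
  have hYd : ∀ k ω, Y k ω = ∑ i, U i k * X i ω := fun k ω => rfl
  have hL2 : ∀ i, MemLp (X i) 2 P := fun i => (hX.eval i).memLp_two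
  have hint : ∀ i, Integrable (X i) P := fun i => (hL2 i).integrable one_le_two
  have hY : HasGaussianLaw (fun ω => (Y · ω)) P := by
    have := hX.map_fun (LinearMap.toContinuousLinearMap (Matrix.toLin' Uᵀ))
    simpa [Y, Matrix.toLin'_apply] using this
  have hY0 : ∀ k, ∫ ω, Y k ω ∂P = 0 := by
    intro k
    simp_rw [hYd]
    rw [integral_finsetSum _ fun i _ => (hint i).const_mul _]
    simp [integral_const_mul, h0]
  have hYc : ∀ k l, ∫ ω, Y k ω * Y l ω ∂P = if k = l then (v k : ℝ) else 0 := by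
    intro k l
    have e : ∀ ω, Y k ω * Y l ω = ∑ i, ∑ j, (U i k * U j l) * (X i ω * X j ω) := by
      intro ω
      rw [hYd, hYd, Finset.sum_mul_sum]
      refine Finset.sum_congr rfl fun i _ => Finset.sum_congr rfl fun j _ => by ring
    have hi : ∀ i j, Integrable (fun ω => (U i k * U j l) * (X i ω * X j ω)) P := fun i j =>
      ((hL2 i).integrable_mul (hL2 j)).const_mul _
    simp_rw [e]
    rw [integral_finsetSum _ fun i _ => integrable_finsetSum _ fun j _ => hi i j]
    have hd := congrFun (congrFun hD k) l
    rw [Matrix.diagonal_apply] at hd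
    rw [← hd, Matrix.mul_apply]
    simp_rw [Matrix.mul_apply, Finset.sum_mul]
    rw [Finset.sum_comm]
    refine Finset.sum_congr rfl fun i _ => ?_
    rw [integral_finsetSum _ fun j _ => hi _ j]
    refine Finset.sum_congr rfl fun j _ => ?_
    rw [integral_const_mul, hc, Matrix.transpose_apply]
    ring
  have hlaw := map_eq_pi_gaussianReal hY hY0 v hYc
  have hB : MeasurableSet {y | U *ᵥ y ∈ A} := by
    have hcont : Continuous fun y : ι → ℝ => U *ᵥ y := by fun_prop
    exact hcont.measurable hA
  rw [← hlaw, Measure.map_apply_of_aemeasurable hX.aemeasurable hA,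
    Measure.map_apply_of_aemeasurable hY.aemeasurable hB]
  congr 1
  ext ω
  simp only [Set.mem_preimage, Set.mem_ofPred_eq]
  have : U *ᵥ (fun i => Y i ω) = fun i => X i ω := by
    change U *ᵥ (Uᵀ *ᵥ _) = _
    rw [Matrix.mulVec_mulVec, hU, Matrix.one_mulVec]
  rw [this]

/-- Spectral theorem. Gershgorin's disc theorem bounds the eigenvalues by the row sums, and the sum
of their squares is the trace of T². -/
theorem exists_orthogonal_diagonalization {ι : Type*} [Fintype ι] [DecidableEq ι]
    {T : Matrix ι ι ℝ} (hT : T.IsHermitian) {r : ℝ} (hr : ∀ i, ∑ j, |T i j| ≤ r) :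
    ∃ (U : Matrix ι ι ℝ) (t : ι → ℝ), U * Uᵀ = 1 ∧ Uᵀ * U = 1 ∧ Uᵀ * T * U = Matrix.diagonal t ∧
      (∀ i, |t i| ≤ r) ∧ ∑ i, t i ^ 2 = ∑ i, ∑ j, T i j ^ 2 := by
  set U : Matrix ι ι ℝ := (hT.eigenvectorUnitary).1 with hUdef
  have hUt : star U = Uᵀ := by
    rw [Matrix.star_eq_conjTranspose, Matrix.conjTranspose_eq_transpose_of_trivial]
  have h1 : U * Uᵀ = 1 := by rw [← hUt]; exact Unitary.mul_star_self_of_mem hT.eigenvectorUnitary.2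
  have h2 : Uᵀ * U = 1 := by rw [← hUt]; exact Unitary.star_mul_self_of_mem hT.eigenvectorUnitary.2
  have h3 : Uᵀ * T * U = Matrix.diagonal hT.eigenvalues := by
    have := hT.conjStarAlgAut_star_eigenvectorUnitary
    rw [Unitary.conjStarAlgAut_star_apply] at this
    rw [← hUt]
    exact this
  refine ⟨U, hT.eigenvalues, h1, h2, h3, fun k => ?_, ?_⟩
  · have hev : Module.End.HasEigenvalue (Matrix.toLin' T) (hT.eigenvalues k) := by
      refine Module.End.hasEigenvalue_of_hasEigenvector (x := ⇑(hT.eigenvectorBasis k)) ⟨?_, ?_⟩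
      · rw [Module.End.mem_eigenspace_iff, Matrix.toLin'_apply]
        exact hT.mulVec_eigenvectorBasis k
      · intro h
        have := hT.eigenvectorBasis.orthonormal.ne_zero k
        exact this (by ext i; exact congrFun h i)
    obtain ⟨i, hi⟩ := eigenvalue_mem_ball hev
    rw [mem_closedBall_iff_norm, Real.norm_eq_abs] at hi
    have hs := hr i
    rw [← Finset.add_sum_erase _ _ (Finset.mem_univ i)] at hs
    have := abs_sub_abs_le_abs_sub (hT.eigenvalues k) (T i i)
    simp only [Real.norm_eq_abs] at hi
    linarith
  · have hD : (Uᵀ * T * U) * (Uᵀ * T * U) = Uᵀ * (T * T) * U := by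
      calc (Uᵀ * T * U) * (Uᵀ * T * U) = Uᵀ * T * (U * Uᵀ) * T * U := by noncomm_ring
        _ = Uᵀ * (T * T) * U := by rw [h1]; noncomm_ring
    have htr : (Uᵀ * (T * T) * U).trace = (T * T).trace := by
      rw [Matrix.trace_mul_cycle, h1, Matrix.one_mul]
    rw [← hD, h3, Matrix.diagonal_mul_diagonal, Matrix.trace_diagonal] at htr
    simp_rw [sq]
    rw [htr, Matrix.trace]
    refine Finset.sum_congr rfl fun i _ => ?_
    rw [Matrix.diag_apply, Matrix.mul_apply]
    refine Finset.sum_congr rfl fun j _ => ?_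
    have := hT.apply i j
    simp only [star_trivial] at this
    rw [this]

/-- If the covariance of a centred Gaussian vector is a small perturbation `1 + T` of the identity
then its law is controlled by the standard Gaussian law. -/
theorem sq_map_le_of_covariance {ι W W' : Type*} [Fintype ι] [DecidableEq ι]
    {mW : MeasurableSpace W} {mW' : MeasurableSpace W'} {P : Measure W} {P' : Measure W'}
    {X : ι → W → ℝ} {X' : ι → W' → ℝ}
    (hX : HasGaussianLaw (fun ω => (X · ω)) P) (hX' : HasGaussianLaw (fun ω => (X' · ω)) P')
    (h0 : ∀ i, ∫ ω, X i ω ∂P = 0) (h0' : ∀ i, ∫ ω, X' i ω ∂P' = 0)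
    {T : Matrix ι ι ℝ} (hT : T.IsHermitian) (hr : ∀ i, ∑ j, |T i j| ≤ 1 / 2)
    (hc : ∀ i j, ∫ ω, X i ω * X j ω ∂P = (1 + T) i j)
    (hc' : ∀ i j, ∫ ω, X' i ω * X' j ω ∂P' = (1 : Matrix ι ι ℝ) i j)
    {A : Set (ι → ℝ)} (hA : MeasurableSet A) :
    (P.map (fun ω i => X i ω) A) ^ 2 ≤
      ENNReal.ofReal (Real.exp (∑ i, ∑ j, T i j ^ 2)) * P'.map (fun ω i => X' i ω) A := by
  obtain ⟨U, t, h1, h2, h3, h4, h5⟩ := exists_orthogonal_diagonalization hT hr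
  -- The truncation is never active: the eigenvalues of T lie in [-1/2, 1/2].
  let v : ι → ℝ≥0 := fun i => (1 + t i).toNNReal
  have hv : ∀ i, (v i : ℝ) = 1 + t i := fun i =>
    Real.coe_toNNReal _ (by have := abs_le.1 (h4 i); linarith)
  have hB : MeasurableSet {y | U *ᵥ y ∈ A} := by
    have hcont : Continuous fun y : ι → ℝ => U *ᵥ y := by fun_prop
    exact hcont.measurable hA
  rw [map_apply_eq_pi_of_orthogonal hX h0 (1 + T) U hc h1 v ?_ hA,
    map_apply_eq_pi_of_orthogonal hX' h0' 1 U hc' h1 (fun _ => 1) ?_ hA]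
  · refine (sq_pi_gaussianReal_le v (fun i => ?_) hB).trans (le_of_eq ?_)
    · rw [hv, add_sub_cancel_left]; exact h4 i
    · simp_rw [hv, add_sub_cancel_left, h5]
  · rw [Matrix.mul_one, h2]
    simp
  · rw [Matrix.mul_add, Matrix.add_mul, Matrix.mul_one, h2, h3]
    ext i j
    simp only [Matrix.add_apply, Matrix.one_apply, Matrix.diagonal_apply, hv]
    split_ifs <;> simp

end SpectralEstimation

/-! ### White noise, moving averages and their spectral densities -/

namespace SpectralEstimation

variable {d : ℕ} {ι : Type*} [Fintype ι]

/-- Gaussian white noise on the grid. -/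
noncomputable def whiteNoise (d : ℕ) : Measure (Grid d → ℝ) :=
  Measure.infinitePi fun _ => gaussianReal 0 1

instance : IsProbabilityMeasure (whiteNoise d) := by
  unfold whiteNoise
  infer_instance

theorem isGaussianProcess_whiteNoise :
    IsGaussianProcess (fun (n : Grid d) (x : Grid d → ℝ) => x n) (whiteNoise d) where
  hasGaussianLaw I := by
    have h : iIndepFun (fun (n : Grid d) (x : Grid d → ℝ) => x n) (whiteNoise d) :=
      iIndepFun_infinitePi (X := fun _ x => x) fun _ => measurable_id
    have h' : iIndepFun (fun (n : I) (x : Grid d → ℝ) => x n.1) (whiteNoise d) :=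
      h.precomp Subtype.val_injective
    refine iIndepFun.hasGaussianLaw (X := fun (n : I) (x : Grid d → ℝ) => x n.1) (fun n => ?_) h'
    have := (measurePreserving_eval_infinitePi (fun _ : Grid d => gaussianReal 0 1) n.1).map_eq
    constructor
    change IsGaussian ((whiteNoise d).map (Function.eval n.1))
    rw [whiteNoise, this]
    infer_instance

theorem integral_whiteNoise (n : Grid d) : ∫ x, x n ∂whiteNoise d = 0 := by
  have := (measurePreserving_eval_infinitePi (fun _ : Grid d => gaussianReal 0 1) n)
  have h := integral_map (μ := whiteNoise d) (φ := Function.eval n) (f := fun x : ℝ => x)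
    this.measurable.aemeasurable (by fun_prop)
  rw [whiteNoise, this.map_eq, integral_id_gaussianReal] at h
  exact h.symm

theorem integral_mul_whiteNoise (n m : Grid d) :
    ∫ x, x n * x m ∂whiteNoise d = if n = m then 1 else 0 := by
  have hg := fun k => (isGaussianProcess_whiteNoise (d := d)).hasGaussianLaw_eval k
  split_ifs with h
  · subst h
    have := (measurePreserving_eval_infinitePi (fun _ : Grid d => gaussianReal 0 1) n)
    have h := integral_map (μ := whiteNoise d) (φ := Function.eval n) (f := fun x : ℝ => x ^ 2)
      this.measurable.aemeasurable (by fun_prop)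
    have hv := variance_of_integral_eq_zero (X := fun x : ℝ => x) (μ := gaussianReal 0 1)
      (by fun_prop) integral_id_gaussianReal
    rw [variance_fun_id_gaussianReal] at hv
    rw [whiteNoise, this.map_eq, ← hv] at h
    simpa [sq, whiteNoise] using h.symm
  · have hi : iIndepFun (fun (n : Grid d) (x : Grid d → ℝ) => x n) (whiteNoise d) :=
      iIndepFun_infinitePi (X := fun _ x => x) fun _ => measurable_id
    have := (hi.indepFun h).integral_fun_mul_eq_mul_integral (hg n).aemeasurable.aestronglyMeasurable
      (hg m).aemeasurable.aestronglyMeasurable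
    rw [this, integral_whiteNoise, zero_mul]

/-- The moving average with coefficients `c i` at the lags `s i`. -/
def movingAverage (c : ι → ℝ) (s : ι → Grid d) (x : Grid d → ℝ) (n : Grid d) : ℝ :=
  ∑ i, c i * x (n - s i)

theorem measurable_movingAverage (c : ι → ℝ) (s : ι → Grid d) :
    Measurable (movingAverage c s) := by
  unfold movingAverage
  fun_prop

/-- The law of a moving average of white noise. -/
noncomputable def movingAverageLaw (c : ι → ℝ) (s : ι → Grid d) : Measure (Grid d → ℝ) :=
  (whiteNoise d).map (movingAverage c s)

instance (c : ι → ℝ) (s : ι → Grid d) : IsProbabilityMeasure (movingAverageLaw c s) :=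
  Measure.isProbabilityMeasure_map (measurable_movingAverage c s).aemeasurable

/-- The autocovariance of a moving average. -/
def movingAverageCov (c : ι → ℝ) (s : ι → Grid d) (n : Grid d) : ℝ :=
  ∑ i, ∑ j, if s i - s j = n then c i * c j else 0

/-- The spectral density of a moving average. -/
noncomputable def movingAverageDensity (c : ι → ℝ) (s : ι → Grid d) (ξ : Fin d → ℝ) : ℝ :=
  ∑ i, ∑ j, c i * c j * Real.cos (2 * Real.pi * ∑ k, ξ k * ((s i - s j) k : ℝ))

theorem integral_mul_movingAverageLaw (c : ι → ℝ) (s : ι → Grid d) (n m : Grid d) :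
    ∫ x, x n * x m ∂movingAverageLaw c s = movingAverageCov c s (n - m) := by
  have hg := fun k => (isGaussianProcess_whiteNoise (d := d)).hasGaussianLaw_eval k
  rw [movingAverageLaw, integral_map (measurable_movingAverage c s).aemeasurable (by fun_prop)]
  have e : ∀ x, movingAverage c s x n * movingAverage c s x m =
      ∑ i, ∑ j, (c i * c j) * (x (n - s i) * x (m - s j)) := by
    intro x
    rw [movingAverage, movingAverage, Finset.sum_mul_sum]
    refine Finset.sum_congr rfl fun i _ => Finset.sum_congr rfl fun j _ => by ring
  have hi : ∀ i j, Integrable (fun x : Grid d → ℝ => (c i * c j) * (x (n - s i) * x (m - s j)))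
      (whiteNoise d) := fun i j =>
    ((hg _).memLp_two.integrable_mul (hg _).memLp_two).const_mul _
  simp_rw [e]
  rw [integral_finsetSum _ fun i _ => integrable_finsetSum _ fun j _ => hi i j]
  refine Finset.sum_congr rfl fun i _ => ?_
  rw [integral_finsetSum _ fun j _ => hi i j]
  refine Finset.sum_congr rfl fun j _ => ?_
  rw [integral_const_mul, integral_mul_whiteNoise]
  have : n - s i = m - s j ↔ s i - s j = n - m := by
    constructor <;> intro h <;> linear_combination -h
  simp [this]

theorem isStationaryGaussian_movingAverageLaw (c : ι → ℝ) (s : ι → Grid d) :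
    IsStationaryGaussian (movingAverageLaw c s) where
  gaussian := by
    have h : IsGaussianProcess (fun (n : Grid d) (x : Grid d → ℝ) => movingAverage c s x n)
        (whiteNoise d) := by
      classical
      refine IsGaussianProcess.of_isGaussianProcess (isGaussianProcess_whiteNoise (d := d)) fun n =>
        ⟨Finset.univ.image (fun i => n - s i),
          ∑ i, c i • ContinuousLinearMap.proj ⟨n - s i, by simp⟩, fun x => ?_⟩
      simp [movingAverage]
    constructor
    intro I
    constructor
    have := (h.hasGaussianLaw I).isGaussian_map
    rw [movingAverageLaw, Measure.map_map (by fun_prop) (measurable_movingAverage c s)]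
    exact this
  mean_zero n := by
    have hg := fun k => (isGaussianProcess_whiteNoise (d := d)).hasGaussianLaw_eval k
    rw [movingAverageLaw, integral_map (measurable_movingAverage c s).aemeasurable
      (measurable_pi_apply n).aestronglyMeasurable]
    simp_rw [movingAverage]
    rw [integral_finsetSum _ fun i _ => (hg _).integrable.const_mul _]
    simp [integral_const_mul, integral_whiteNoise]
  stationary n m k := by
    rw [integral_mul_movingAverageLaw, integral_mul_movingAverageLaw, add_sub_add_right_eq_sub]

theorem hasSpectralDensity_movingAverageLaw (c : ι → ℝ) (s : ι → Grid d) :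
    HasSpectralDensity (movingAverageLaw c s) (movingAverageDensity c s) := by
  intro ξ
  let e : Grid d → ℂ := fun n =>
    Complex.exp (2 * (Real.pi : ℂ) * Complex.I * ((∑ i, ξ i * (n i : ℝ) : ℝ) : ℂ))
  let θ : Grid d → ℝ := fun n => 2 * Real.pi * ∑ k, ξ k * (n k : ℝ)
  have he : ∀ n, e n = (Real.cos (θ n) : ℂ) + (Real.sin (θ n) : ℂ) * Complex.I := by
    intro n
    rw [Complex.ofReal_cos, Complex.ofReal_sin, ← Complex.exp_mul_I]
    simp only [e, θ]
    congr 1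
    push_cast
    ring
  have hsum : HasSum (fun n : Grid d => (autocov (movingAverageLaw c s) n : ℂ) * e n)
      (∑ i, ∑ j, (c i * c j : ℂ) * e (s i - s j)) := by
    have hcov : ∀ n, (autocov (movingAverageLaw c s) n : ℂ) * e n =
        ∑ i, ∑ j, if n = s i - s j then (c i * c j : ℂ) * e (s i - s j) else 0 := by
      intro n
      rw [autocov, integral_mul_movingAverageLaw, sub_zero, movingAverageCov]
      push_cast
      rw [Finset.sum_mul]
      refine Finset.sum_congr rfl fun i _ => ?_
      rw [Finset.sum_mul]
      refine Finset.sum_congr rfl fun j _ => ?_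
      by_cases h : n = s i - s j
      · simp [h]
      · simp [h, Ne.symm h]
    simp_rw [hcov]
    exact hasSum_sum fun i _ => hasSum_sum fun j _ => hasSum_ite_eq (s i - s j) _
  have hval : (∑ i, ∑ j, (c i * c j : ℂ) * e (s i - s j)) = (movingAverageDensity c s ξ : ℂ) := by
    -- The imaginary part is antisymmetric under exchange of i and j.
    have hanti : ∑ i, ∑ j, c i * c j * Real.sin (θ (s i - s j)) = 0 := by
      have h1 : ∑ i, ∑ j, c i * c j * Real.sin (θ (s i - s j)) =
          -∑ i, ∑ j, c i * c j * Real.sin (θ (s i - s j)) := by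
        conv_lhs => rw [Finset.sum_comm]
        simp_rw [← Finset.sum_neg_distrib]
        refine Finset.sum_congr rfl fun i _ => Finset.sum_congr rfl fun j _ => ?_
        have : θ (s j - s i) = -θ (s i - s j) := by
          simp only [θ, ← mul_neg, ← Finset.sum_neg_distrib]
          congr 1
          refine Finset.sum_congr rfl fun k _ => ?_
          simp only [Pi.sub_apply, Int.cast_sub]
          ring
        rw [this, Real.sin_neg]
        ring
      linarith
    have : (∑ i, ∑ j, (c i * c j : ℂ) * e (s i - s j)) =
        (movingAverageDensity c s ξ : ℂ) +
          ((∑ i, ∑ j, c i * c j * Real.sin (θ (s i - s j)) : ℝ) : ℂ) * Complex.I := by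
      simp only [movingAverageDensity, Complex.ofReal_sum, Finset.sum_mul, ← Finset.sum_add_distrib]
      refine Finset.sum_congr rfl fun i _ => Finset.sum_congr rfl fun j _ => ?_
      rw [he]
      simp only [θ]
      push_cast
      ring
    rw [this, hanti]
    simp
  rw [← hval]
  exact hsum

/-- The density is the squared modulus of the transfer function, split into real and imaginary
parts. -/
theorem movingAverageDensity_eq (c : ι → ℝ) (s : ι → Grid d) (ξ : Fin d → ℝ) :
    movingAverageDensity c s ξ =
      (∑ i, c i * Real.cos (2 * Real.pi * ∑ k, ξ k * (s i k : ℝ))) ^ 2 +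
      (∑ i, c i * Real.sin (2 * Real.pi * ∑ k, ξ k * (s i k : ℝ))) ^ 2 := by
  rw [sq, sq, Finset.sum_mul_sum, Finset.sum_mul_sum, ← Finset.sum_add_distrib,
    movingAverageDensity]
  refine Finset.sum_congr rfl fun i _ => ?_
  rw [← Finset.sum_add_distrib]
  refine Finset.sum_congr rfl fun j _ => ?_
  have : 2 * Real.pi * ∑ k, ξ k * ((s i - s j) k : ℝ) =
      2 * Real.pi * ∑ k, ξ k * (s i k : ℝ) - 2 * Real.pi * ∑ k, ξ k * (s j k : ℝ) := by
    rw [← mul_sub, ← Finset.sum_sub_distrib]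
    congr 1
    refine Finset.sum_congr rfl fun k _ => ?_
    simp only [Pi.sub_apply, Int.cast_sub]
    ring
  rw [this, Real.cos_sub]
  ring

/-! ### The C² norm of trigonometric polynomials and admissibility -/

theorem uniformNorm_le {f : (Fin d → ℝ) → ℝ} {r : ℝ} (h : ∀ ξ, |f ξ| ≤ r) :
    uniformNorm f ≤ ENNReal.ofReal r :=
  iSup_le fun ξ => ENNReal.ofReal_le_ofReal (h ξ)

/-- A trigonometric polynomial with frequencies `L p` has `C²` norm at most one if its weighted
coefficient sums are. -/
theorem contDiff_and_c2Norm_le_one (w : ι → ℝ) (L : ι → (Fin d → ℝ) →L[ℝ] ℝ)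
    (h0 : ∑ p, |w p| ≤ 1) (h1 : ∀ j, ∑ p, |w p| * |L p (Pi.single j 1)| ≤ 1)
    (h2 : ∀ j k, ∑ p, |w p| * (|L p (Pi.single j 1)| * |L p (Pi.single k 1)|) ≤ 1) :
    ContDiff ℝ 2 (fun ξ => ∑ p, w p * Real.cos (L p ξ)) ∧
      c2Norm (fun ξ => ∑ p, w p * Real.cos (L p ξ)) ≤ 1 := by
  have d1 : ∀ k, partialDeriv k (fun ξ => ∑ p, w p * Real.cos (L p ξ)) =
      fun ξ => ∑ p, w p * (-Real.sin (L p ξ) * L p (Pi.single k 1)) := by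
    intro k
    ext ξ
    have hd : HasFDerivAt (fun ξ => ∑ p, w p * Real.cos (L p ξ))
        (∑ p, w p • (-Real.sin (L p ξ) • L p)) ξ :=
      HasFDerivAt.fun_sum fun p _ => ((L p).hasFDerivAt.cos).const_mul (w p)
    rw [partialDeriv, hd.fderiv]
    simp
  have d2 : ∀ j k, partialDeriv j (partialDeriv k (fun ξ => ∑ p, w p * Real.cos (L p ξ))) =
      fun ξ => ∑ p, w p * (-Real.cos (L p ξ) * (L p (Pi.single j 1) * L p (Pi.single k 1))) := by
    intro j k
    rw [d1]
    ext ξ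
    have hd : HasFDerivAt (fun ξ => ∑ p, w p * (-Real.sin (L p ξ) * L p (Pi.single k 1)))
        (∑ p, w p • (L p (Pi.single k 1) • (-(Real.cos (L p ξ) • L p)))) ξ :=
      HasFDerivAt.fun_sum fun p _ =>
        (((L p).hasFDerivAt.sin).neg.mul_const (L p (Pi.single k 1))).const_mul (w p)
    rw [partialDeriv, hd.fderiv]
    simp only [_root_.sum_apply, _root_.smul_apply,
      _root_.neg_apply, smul_eq_mul]
    exact Finset.sum_congr rfl fun p _ => by ring
  refine ⟨by fun_prop, ?_⟩
  rw [← ENNReal.ofReal_one]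
  refine sup_le (sup_le (uniformNorm_le fun ξ => ?_) (iSup_le fun k => uniformNorm_le fun ξ => ?_))
    (iSup_le fun j => iSup_le fun k => uniformNorm_le fun ξ => ?_)
  · refine ((Finset.abs_sum_le_sum_abs _ _).trans (Finset.sum_le_sum fun p _ => ?_)).trans h0
    rw [abs_mul]
    exact mul_le_of_le_one_right (abs_nonneg _) (Real.abs_cos_le_one _)
  · rw [d1]
    refine ((Finset.abs_sum_le_sum_abs _ _).trans (Finset.sum_le_sum fun p _ => ?_)).trans (h1 k)
    rw [abs_mul, abs_mul, abs_neg]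
    exact mul_le_mul_of_nonneg_left
      (mul_le_of_le_one_left (abs_nonneg _) (Real.abs_sin_le_one _)) (abs_nonneg _)
  · rw [d2]
    refine ((Finset.abs_sum_le_sum_abs _ _).trans (Finset.sum_le_sum fun p _ => ?_)).trans (h2 j k)
    rw [abs_mul, abs_mul, abs_neg, abs_mul (L p (Pi.single j 1))]
    exact mul_le_mul_of_nonneg_left
      (mul_le_of_le_one_left (by positivity) (Real.abs_cos_le_one _)) (abs_nonneg _)

/-- The law of a moving average is admissible under summability conditions on the coefficients. -/
theorem isAdmissible_movingAverageLaw (c : ι → ℝ) (s : ι → Grid d)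
    (h0 : ∑ i, ∑ j, |c i * c j| ≤ 1)
    (h1 : ∀ k, ∑ i, ∑ j, |c i * c j| * |2 * Real.pi * ((s i - s j) k : ℝ)| ≤ 1)
    (h2 : ∀ k l, ∑ i, ∑ j, |c i * c j| *
      (|2 * Real.pi * ((s i - s j) k : ℝ)| * |2 * Real.pi * ((s i - s j) l : ℝ)|) ≤ 1) :
    IsAdmissible (movingAverageLaw c s) (movingAverageDensity c s) := by
  let L : ι × ι → (Fin d → ℝ) →L[ℝ] ℝ := fun p =>
    (2 * Real.pi) • ∑ k, ((s p.1 - s p.2) k : ℝ) • ContinuousLinearMap.proj k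
  have hL : ∀ p k, L p (Pi.single k 1) = 2 * Real.pi * ((s p.1 - s p.2) k : ℝ) := by
    intro p k
    simp [L, Pi.single_apply]
  have hf : movingAverageDensity c s =
      fun ξ => ∑ p : ι × ι, (c p.1 * c p.2) * Real.cos (L p ξ) := by
    ext ξ
    rw [movingAverageDensity, Fintype.sum_prod_type]
    refine Finset.sum_congr rfl fun i _ => Finset.sum_congr rfl fun j _ => ?_
    congr 2
    simp only [L, _root_.smul_apply, _root_.sum_apply, smul_eq_mul,
      ContinuousLinearMap.proj_apply]
    congr 1
    exact Finset.sum_congr rfl fun k _ => mul_comm _ _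
  have h := contDiff_and_c2Norm_le_one (fun p : ι × ι => c p.1 * c p.2) L
    (by rw [Fintype.sum_prod_type]; exact h0)
    (fun k => by simp only [hL]; rw [Fintype.sum_prod_type]; exact h1 k)
    (fun k l => by simp only [hL]; rw [Fintype.sum_prod_type]; exact h2 k l)
  rw [← hf] at h
  exact ⟨isStationaryGaussian_movingAverageLaw c s, hasSpectralDensity_movingAverageLaw c s,
    h.1, h.2⟩

end SpectralEstimation

/-! ### The bump hypotheses and orthogonality on the frequency grid -/

namespace SpectralEstimation

/-- The lags of the perturbed moving averages: the origin, and the points of `[0, m)^d`. -/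
def boxLag (d m : ℕ) : Option (Fin d → Fin m) → Grid d
  | none => 0
  | some b => fun k => ((b k : ℕ) : ℤ)

/-- The size of the perturbation of the coefficient at each point of the box. -/
noncomputable def amplitude (d m : ℕ) (a : ℝ) : ℝ := a / (m ^ 2 * m ^ d)

/-- The coefficients of a moving average whose transfer function is `1/2` plus a small bump of
width `1/m` at the frequencies `±x`. -/
noncomputable def bumpCoef (d m : ℕ) (a : ℝ) (x : Fin d → ℝ) : Option (Fin d → Fin m) → ℝ
  | none => 1 / 2
  | some b => amplitude d m a * Real.cos (2 * Real.pi * ∑ k, x k * ((b k : ℕ) : ℝ))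

section TrigSums

variable {d m : ℕ}

/-- The sum factors over the coordinates into geometric sums of m-th roots of unity; a single root
different from 1 makes the product vanish. -/
theorem sum_exp_box_eq_zero (hm : 0 < m) (u : Fin d → ℤ) (hu : ∃ k, ¬ (m : ℤ) ∣ u k) :
    ∑ b : Fin d → Fin m,
      Complex.exp (((2 * Real.pi * ∑ k, (u k : ℝ) / m * ((b k : ℕ) : ℝ) : ℝ) : ℂ) * Complex.I) = 0 := by
  have hm0 : (m : ℂ) ≠ 0 := by exact_mod_cast hm.ne'
  let z : Fin d → ℂ := fun k => Complex.exp (2 * Real.pi * Complex.I * ((u k : ℂ) / m))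
  have h1 : ∀ b : Fin d → Fin m,
      Complex.exp (((2 * Real.pi * ∑ k, (u k : ℝ) / m * ((b k : ℕ) : ℝ) : ℝ) : ℂ) * Complex.I) =
        ∏ k, z k ^ (b k : ℕ) := by
    intro b
    simp only [z, ← Complex.exp_nat_mul]
    rw [← Complex.exp_sum]
    congr 1
    push_cast
    rw [Finset.mul_sum, Finset.sum_mul]
    exact Finset.sum_congr rfl fun k _ => by ring
  simp_rw [h1]
  have h2 := Finset.prod_univ_sum (fun _ : Fin d => (Finset.univ : Finset (Fin m)))
    (fun k (b : Fin m) => z k ^ (b : ℕ))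
  rw [Fintype.piFinset_univ] at h2
  rw [← h2]
  obtain ⟨k, hk⟩ := hu
  refine Finset.prod_eq_zero (Finset.mem_univ k) ?_
  rw [Fin.sum_univ_eq_sum_range (fun i => z k ^ i)]
  have hz1 : z k ≠ 1 := by
    intro h
    obtain ⟨n, hn⟩ := Complex.exp_eq_one_iff.1 h
    refine hk ⟨n, ?_⟩
    have h2 : (u k : ℂ) / m = n := by
      have := Complex.two_pi_I_ne_zero
      apply mul_left_cancel₀ this
      rw [hn]; ring
    rw [div_eq_iff hm0] at h2
    have h3 : (u k : ℂ) = ((m * n : ℤ) : ℂ) := by rw [h2]; push_cast; ring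
    exact_mod_cast h3
  have hzm : z k ^ m = 1 := by
    simp only [z]
    rw [← Complex.exp_nat_mul]
    refine Complex.exp_eq_one_iff.2 ⟨u k, ?_⟩
    field_simp
  rw [geom_sum_eq hz1, hzm, sub_self, zero_div]

theorem sum_cos_box_eq_zero (hm : 0 < m) (u : Fin d → ℤ) (hu : ∃ k, ¬ (m : ℤ) ∣ u k) :
    ∑ b : Fin d → Fin m, Real.cos (2 * Real.pi * ∑ k, (u k : ℝ) / m * ((b k : ℕ) : ℝ)) = 0 := by
  have h := congrArg Complex.re (sum_exp_box_eq_zero hm u hu)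
  rw [Complex.re_sum, Complex.zero_re] at h
  simpa only [Complex.exp_ofReal_mul_I_re] using h

theorem sum_sin_box_eq_zero (hm : 0 < m) (u : Fin d → ℤ) (hu : ∃ k, ¬ (m : ℤ) ∣ u k) :
    ∑ b : Fin d → Fin m, Real.sin (2 * Real.pi * ∑ k, (u k : ℝ) / m * ((b k : ℕ) : ℝ)) = 0 := by
  have h := congrArg Complex.im (sum_exp_box_eq_zero hm u hu)
  rw [Complex.im_sum, Complex.zero_im] at h
  simpa only [Complex.exp_ofReal_mul_I_im] using h

/-- Frequencies in the interior of the half period with denominator `2 p + 1`. -/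
noncomputable def gridFreq {d p : ℕ} (j : Fin d → Fin p) : Fin d → ℝ :=
  fun k => (((j k : ℕ) + 1 : ℤ) : ℝ) / ((2 * p + 1 : ℕ) : ℝ)

variable {p : ℕ}

/-- The sum of two numerators lies between 2 and 2p. Starting the numerators at 1 and taking the
denominator 2p+1 serves to keep x + x' off the integer lattice, so that the mirror bumps at -x do
not interfere. -/
theorem gridFreq_sum_not_dvd (hd : 0 < d) (i j : Fin d → Fin p) :
    ∃ k, ¬ ((2 * p + 1 : ℕ) : ℤ) ∣ ((((i k : ℕ) : ℤ) + 1) + (((j k : ℕ) : ℤ) + 1)) := by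
  refine ⟨⟨0, hd⟩, fun h => ?_⟩
  have h1 := (i ⟨0, hd⟩).2
  have h2 := (j ⟨0, hd⟩).2
  have := Int.le_of_dvd (by positivity) h
  omega

theorem gridFreq_sub_not_dvd {i j : Fin d → Fin p} (hij : i ≠ j) :
    ∃ k, ¬ ((2 * p + 1 : ℕ) : ℤ) ∣ ((((i k : ℕ) : ℤ) + 1) - (((j k : ℕ) : ℤ) + 1)) := by
  obtain ⟨k, hk⟩ := Function.ne_iff.1 hij
  refine ⟨k, fun h => ?_⟩
  have h1 := (i k).2
  have h2 := (j k).2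
  have h3 : (i k : ℕ) ≠ (j k : ℕ) := fun h => hk (Fin.ext h)
  have := Int.eq_zero_of_abs_lt_dvd h (by rw [abs_lt]; constructor <;> omega)
  omega

theorem gridFreq_phase_add (i j : Fin d → Fin p) (b : Fin d → Fin (2 * p + 1)) :
    2 * Real.pi * ∑ k, gridFreq i k * ((b k : ℕ) : ℝ) + 2 * Real.pi * ∑ k, gridFreq j k * ((b k : ℕ) : ℝ)
      = 2 * Real.pi * ∑ k, ((((((i k : ℕ) : ℤ) + 1) + (((j k : ℕ) : ℤ) + 1) : ℤ) : ℝ) /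
        ((2 * p + 1 : ℕ) : ℝ)) * ((b k : ℕ) : ℝ) := by
  rw [← mul_add, ← Finset.sum_add_distrib]
  congr 1
  refine Finset.sum_congr rfl fun k _ => ?_
  simp only [gridFreq]
  push_cast
  ring

theorem gridFreq_phase_sub (i j : Fin d → Fin p) (b : Fin d → Fin (2 * p + 1)) :
    2 * Real.pi * ∑ k, gridFreq i k * ((b k : ℕ) : ℝ) - 2 * Real.pi * ∑ k, gridFreq j k * ((b k : ℕ) : ℝ)
      = 2 * Real.pi * ∑ k, ((((((i k : ℕ) : ℤ) + 1) - (((j k : ℕ) : ℤ) + 1) : ℤ) : ℝ) /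
        ((2 * p + 1 : ℕ) : ℝ)) * ((b k : ℕ) : ℝ) := by
  rw [← mul_sub, ← Finset.sum_sub_distrib]
  congr 1
  refine Finset.sum_congr rfl fun k _ => ?_
  simp only [gridFreq]
  push_cast
  ring

/-- The product-to-sum formula leaves only the frequencies x + x' and x - x', neither of which is an
integer vector. -/
theorem sum_cos_mul_cos_of_ne (hd : 0 < d) {i j : Fin d → Fin p} (hij : i ≠ j) :
    ∑ b : Fin d → Fin (2 * p + 1), Real.cos (2 * Real.pi * ∑ k, gridFreq i k * ((b k : ℕ) : ℝ)) *
      Real.cos (2 * Real.pi * ∑ k, gridFreq j k * ((b k : ℕ) : ℝ)) = 0 := by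
  have e : ∀ x y : ℝ, Real.cos x * Real.cos y = (Real.cos (x + y) + Real.cos (x - y)) / 2 := by
    intro x y
    rw [Real.cos_add, Real.cos_sub]; ring
  simp_rw [e, gridFreq_phase_add, gridFreq_phase_sub]
  rw [← Finset.sum_div, Finset.sum_add_distrib,
    sum_cos_box_eq_zero (Nat.succ_pos _) _ (gridFreq_sum_not_dvd hd i j),
    sum_cos_box_eq_zero (Nat.succ_pos _) _ (gridFreq_sub_not_dvd hij)]
  simp

theorem sum_cos_mul_sin_of_ne (hd : 0 < d) {i j : Fin d → Fin p} (hij : i ≠ j) :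
    ∑ b : Fin d → Fin (2 * p + 1), Real.cos (2 * Real.pi * ∑ k, gridFreq i k * ((b k : ℕ) : ℝ)) *
      Real.sin (2 * Real.pi * ∑ k, gridFreq j k * ((b k : ℕ) : ℝ)) = 0 := by
  have e : ∀ x y : ℝ, Real.cos x * Real.sin y = (Real.sin (x + y) - Real.sin (x - y)) / 2 := by
    intro x y
    rw [Real.sin_add, Real.sin_sub]; ring
  simp_rw [e, gridFreq_phase_add, gridFreq_phase_sub]
  rw [← Finset.sum_div, Finset.sum_sub_distrib,
    sum_sin_box_eq_zero (Nat.succ_pos _) _ (gridFreq_sum_not_dvd hd i j),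
    sum_sin_box_eq_zero (Nat.succ_pos _) _ (gridFreq_sub_not_dvd hij)]
  simp

theorem sum_cos_mul_cos_self (hd : 0 < d) (i : Fin d → Fin p) :
    ∑ b : Fin d → Fin (2 * p + 1), Real.cos (2 * Real.pi * ∑ k, gridFreq i k * ((b k : ℕ) : ℝ)) *
      Real.cos (2 * Real.pi * ∑ k, gridFreq i k * ((b k : ℕ) : ℝ)) =
        ((2 * p + 1 : ℕ) : ℝ) ^ d / 2 := by
  have e : ∀ x y : ℝ, Real.cos x * Real.cos y = (Real.cos (x + y) + Real.cos (x - y)) / 2 := by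
    intro x y
    rw [Real.cos_add, Real.cos_sub]; ring
  simp_rw [e, sub_self, gridFreq_phase_add]
  rw [← Finset.sum_div, Finset.sum_add_distrib,
    sum_cos_box_eq_zero (Nat.succ_pos _) _ (gridFreq_sum_not_dvd hd i i)]
  simp

/-- The spectral density with a bump at the frequency `gridFreq i`, at the other grid points. -/
theorem density_gridFreq_of_ne (hd : 0 < d) (a : ℝ) {i j : Fin d → Fin p} (hij : i ≠ j) :
    movingAverageDensity (bumpCoef d (2 * p + 1) a (gridFreq i)) (boxLag d (2 * p + 1))
      (gridFreq j) = 1 / 4 := by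
  rw [movingAverageDensity_eq, Fintype.sum_option, Fintype.sum_option]
  simp only [bumpCoef, boxLag, mul_assoc (amplitude _ _ _), Int.cast_natCast, ← Finset.mul_sum]
  rw [sum_cos_mul_cos_of_ne hd hij, sum_cos_mul_sin_of_ne hd hij]
  simp
  norm_num

/-- With q = a/(2m²) the real part of the transfer function is 1/2 + q, whose square is at least 1/4
+ q; the squared imaginary part is discarded. -/
theorem density_gridFreq_self (hd : 0 < d) (a : ℝ) (i : Fin d → Fin p) :
    1 / 4 + a / (2 * ((2 * p + 1 : ℕ) : ℝ) ^ 2) ≤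
    movingAverageDensity (bumpCoef d (2 * p + 1) a (gridFreq i)) (boxLag d (2 * p + 1))
      (gridFreq i) := by
  rw [movingAverageDensity_eq, Fintype.sum_option, Fintype.sum_option]
  simp only [bumpCoef, boxLag, mul_assoc (amplitude _ _ _), Int.cast_natCast, ← Finset.mul_sum]
  rw [sum_cos_mul_cos_self hd]
  have h1 : amplitude d (2 * p + 1) a * (((2 * p + 1 : ℕ) : ℝ) ^ d / 2) =
      a / (2 * ((2 * p + 1 : ℕ) : ℝ) ^ 2) := by
    rw [amplitude]
    have : ((2 * p + 1 : ℕ) : ℝ) ≠ 0 := by positivity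
    field_simp
  rw [h1]
  set q := a / (2 * ((2 * p + 1 : ℕ) : ℝ) ^ 2)
  simp only [Pi.zero_apply, Int.cast_zero, mul_zero, Finset.sum_const_zero, Real.cos_zero]
  nlinarith [sq_nonneg q, sq_nonneg (1 / 2 * Real.sin 0 + amplitude d (2 * p + 1) a *
    ∑ b : Fin d → Fin (2 * p + 1), Real.cos (2 * Real.pi * ∑ k, gridFreq i k * ((b k : ℕ) : ℝ)) *
      Real.sin (2 * Real.pi * ∑ k, gridFreq i k * ((b k : ℕ) : ℝ)))]

end TrigSums

/-! ### Admissibility of the bumps and size of the covariance perturbation -/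

section Bounds

variable {d m : ℕ} {a : ℝ} {x : Fin d → ℝ}

theorem amplitude_nonneg (ha : 0 ≤ a) : 0 ≤ amplitude d m a := by
  unfold amplitude
  positivity

theorem card_mul_amplitude (hm : 0 < m) : (m : ℝ) ^ d * amplitude d m a = a / m ^ 2 := by
  have : (m : ℝ) ≠ 0 := by exact_mod_cast hm.ne'
  rw [amplitude]
  field_simp

theorem div_sq_le (ha : 0 ≤ a) (hm : 0 < m) : a / (m : ℝ) ^ 2 ≤ a := by
  have : (1 : ℝ) ≤ m := by exact_mod_cast hm
  exact div_le_self ha (one_le_pow₀ this)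

theorem abs_bumpCoef_some_le (ha : 0 ≤ a) (b : Fin d → Fin m) :
    |bumpCoef d m a x (some b)| ≤ amplitude d m a := by
  rw [bumpCoef, abs_mul, abs_of_nonneg (amplitude_nonneg ha)]
  exact mul_le_of_le_one_right (amplitude_nonneg ha) (Real.abs_cos_le_one _)

theorem sum_abs_bumpCoef_some_le (ha : 0 ≤ a) (hm : 0 < m) :
    ∑ b : Fin d → Fin m, |bumpCoef d m a x (some b)| ≤ a / m ^ 2 := by
  refine (Finset.sum_le_sum fun b _ => abs_bumpCoef_some_le ha b).trans (le_of_eq ?_)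
  simp [← card_mul_amplitude (d := d) (a := a) hm]

/-- Bound for double sums in which the product of the two central coefficients is left out. -/
theorem sum_sum_bumpCoef_le (ha : 0 ≤ a) (ha1 : a ≤ 1) (hm : 0 < m) {R : ℝ} (hR : 0 ≤ R)
    (F : Option (Fin d → Fin m) → Option (Fin d → Fin m) → ℝ) (hF0 : F none none ≤ 0)
    (hF : ∀ i j, F i j ≤ |bumpCoef d m a x i * bumpCoef d m a x j| * R) :
    ∑ i, ∑ j, F i j ≤ 2 * (a / m ^ 2) * R := by
  set q := a / (m : ℝ) ^ 2 with hq
  have hq0 : 0 ≤ q := by positivity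
  have hq1 : q ≤ 1 := (div_sq_le ha hm).trans ha1
  have hs := sum_abs_bumpCoef_some_le (x := x) (d := d) ha hm
  rw [← hq] at hs
  set s := ∑ b : Fin d → Fin m, |bumpCoef d m a x (some b)|
  have hs0 : 0 ≤ s := Finset.sum_nonneg fun _ _ => abs_nonneg _
  rw [Fintype.sum_option, Fintype.sum_option]
  have hc : |bumpCoef d m a x none| = 1 / 2 := by rw [bumpCoef]; norm_num
  have h1 : ∑ b, F none (some b) ≤ 1 / 2 * s * R := by
    rw [Finset.mul_sum, Finset.sum_mul]
    refine Finset.sum_le_sum fun b _ => (hF _ _).trans (le_of_eq ?_)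
    rw [abs_mul, hc]
  have h2 : ∑ b, ∑ j, F (some b) j ≤ s * (1 / 2 + s) * R := by
    rw [Finset.sum_mul, Finset.sum_mul]
    refine Finset.sum_le_sum fun b _ => ?_
    refine (Finset.sum_le_sum fun j _ => hF _ j).trans (le_of_eq ?_)
    rw [← Finset.sum_mul]
    simp_rw [abs_mul]
    rw [← Finset.mul_sum, Fintype.sum_option, hc]
  -- The left side is s + s², and s ≤ q ≤ 1.
  have h3 : 1 / 2 * s + s * (1 / 2 + s) ≤ 2 * q := by nlinarith
  nlinarith [mul_le_mul_of_nonneg_right h3 hR]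

theorem boxLag_injective : Function.Injective fun b : Fin d → Fin m => boxLag d m (some b) := by
  intro b b' h
  ext k
  have := congrFun h k
  simp only [boxLag] at this
  exact_mod_cast this

theorem abs_boxLag_sub_le (i j : Option (Fin d → Fin m)) (k : Fin d) :
    |(((boxLag d m i - boxLag d m j) k : ℤ) : ℝ)| ≤ m := by
  have h : ∀ i : Option (Fin d → Fin m), 0 ≤ boxLag d m i k ∧ boxLag d m i k ≤ m := by
    intro i
    cases i with
    | none => simp [boxLag]
    | some b =>
      have := (b k).2
      simp only [boxLag]
      omega
  have h1 := h i
  have h2 := h j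
  have : |(boxLag d m i - boxLag d m j) k| ≤ (m : ℤ) := by
    rw [Pi.sub_apply, abs_le]
    constructor <;> linarith
  exact_mod_cast this

/-- Lags differ by at most m in each coordinate, so each derivative costs at most 2πm. The weight
a/m² absorbs two of them, and what remains is the numerical condition 8π²a ≤ 1. -/
theorem isAdmissible_bump (ha : 0 ≤ a) (ha1 : a ≤ 1 / 200) (hm : 0 < m) :
    IsAdmissible (movingAverageLaw (bumpCoef d m a x) (boxLag d m))
      (movingAverageDensity (bumpCoef d m a x) (boxLag d m)) := by
  have hm1 : (1 : ℝ) ≤ m := by exact_mod_cast hm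
  have hpi := Real.pi_lt_d2
  have hpi0 := Real.pi_pos
  have hlag : ∀ i j k, |2 * Real.pi * (((boxLag d m i - boxLag d m j) k : ℤ) : ℝ)| ≤
      2 * Real.pi * m := by
    intro i j k
    rw [abs_mul, abs_of_pos (by positivity : (0 : ℝ) < 2 * Real.pi)]
    gcongr
    exact abs_boxLag_sub_le i j k
  refine isAdmissible_movingAverageLaw _ _ ?_ (fun k => ?_) fun k l => ?_
  · simp_rw [abs_mul]
    rw [← Finset.sum_mul_sum, Fintype.sum_option]
    have hc : |bumpCoef d m a x none| = 1 / 2 := by rw [bumpCoef]; norm_num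
    have hs := sum_abs_bumpCoef_some_le (x := x) (d := d) ha hm
    have hq := div_sq_le ha hm
    have hs0 : 0 ≤ ∑ b : Fin d → Fin m, |bumpCoef d m a x (some b)| :=
      Finset.sum_nonneg fun _ _ => abs_nonneg _
    rw [hc]
    nlinarith
  · refine (sum_sum_bumpCoef_le (x := x) ha (by linarith) hm
      (by positivity : 0 ≤ 2 * Real.pi * m) _ (by simp) fun i j => ?_).trans ?_
    · exact mul_le_mul_of_nonneg_left (hlag i j k) (abs_nonneg _)
    · have : 2 * (a / (m : ℝ) ^ 2) * (2 * Real.pi * m) = 4 * Real.pi * a / m := by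
        field_simp
        ring
      rw [this, div_le_one (by linarith)]
      nlinarith
  · refine (sum_sum_bumpCoef_le (x := x) ha (by linarith) hm
      (by positivity : 0 ≤ (2 * Real.pi * m) * (2 * Real.pi * m)) _ (by simp) fun i j => ?_).trans ?_
    · exact mul_le_mul_of_nonneg_left
        (mul_le_mul (hlag i j k) (hlag i j l) (abs_nonneg _) (by positivity)) (abs_nonneg _)
    · have : 2 * (a / (m : ℝ) ^ 2) * ((2 * Real.pi * m) * (2 * Real.pi * m)) =
          8 * Real.pi ^ 2 * a := by
        field_simp
        ring
      rw [this]
      nlinarith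

/-- The deviation of four times the autocovariance from that of standard white noise. -/
noncomputable def covExcess (d m : ℕ) (a : ℝ) (x : Fin d → ℝ) (n : Grid d) : ℝ :=
  4 * movingAverageCov (bumpCoef d m a x) (boxLag d m) n - if n = 0 then 1 else 0

/-- The terms of the autocovariance other than the central one, in absolute value. -/
noncomputable def offTerm (d m : ℕ) (a : ℝ) (x : Fin d → ℝ) (n : Grid d)
    (i j : Option (Fin d → Fin m)) : ℝ :=
  if i = none ∧ j = none then 0
  else if boxLag d m i - boxLag d m j = n then |bumpCoef d m a x i * bumpCoef d m a x j| else 0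

/-- The factor 4 normalizes the square of the central coefficient 1/2 to 1, so the central pair
cancels the white noise covariance exactly. -/
theorem abs_covExcess_le (n : Grid d) :
    |covExcess d m a x n| ≤ 4 * ∑ i, ∑ j, offTerm d m a x n i j := by
  have h : covExcess d m a x n = 4 * ∑ i, ∑ j, if i = none ∧ j = none then 0 else
      if boxLag d m i - boxLag d m j = n then bumpCoef d m a x i * bumpCoef d m a x j else 0 := by
    rw [covExcess, movingAverageCov]
    simp_rw [Fintype.sum_option]
    simp only [boxLag, bumpCoef, sub_self, and_self, if_true, reduceCtorEq, and_false, false_and,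
      if_false]
    by_cases hn : n = 0
    · simp [hn]; ring
    · simp [hn, Ne.symm hn]
  rw [h, abs_mul, abs_of_pos (by norm_num : (0 : ℝ) < 4)]
  refine mul_le_mul_of_nonneg_left ?_ (by norm_num)
  refine (Finset.abs_sum_le_sum_abs _ _).trans (Finset.sum_le_sum fun i _ => ?_)
  refine (Finset.abs_sum_le_sum_abs _ _).trans (Finset.sum_le_sum fun j _ => ?_)
  rw [offTerm]
  split_ifs <;> simp

theorem sum_ite_eq_le_of_injective {α β : Type*} [Fintype α] [DecidableEq β] {g : α → β}
    (hg : Function.Injective g) (n : β) {f : α → ℝ} {r : ℝ} (hr : 0 ≤ r) (hf : ∀ y, f y ≤ r) :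
    ∑ y, (if g y = n then f y else 0) ≤ r := by
  classical
  by_cases h : ∃ y, g y = n
  · obtain ⟨y, hy⟩ := h
    rw [Finset.sum_eq_single y]
    · simp [hy, hf]
    · intro z _ hz
      rw [if_neg]
      rintro h
      exact hz (hg (h.trans hy.symm))
    · simp
  · rw [Finset.sum_eq_zero]
    · exact hr
    · intro y _
      rw [if_neg]
      exact fun hy => h ⟨y, hy⟩

/-- A given lag arises at most once from centre and box, in either order, and from at most m^d pairs
in the box. The latter contribute at most m^d·`amplitude`² ≤ `amplitude`. -/
theorem abs_covExcess_le_amplitude (ha : 0 ≤ a) (ha1 : a ≤ 1) (hm : 0 < m) (n : Grid d) :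
    |covExcess d m a x n| ≤ 8 * amplitude d m a := by
  refine (abs_covExcess_le n).trans ?_
  have hA := amplitude_nonneg (d := d) (m := m) ha
  have hc : |bumpCoef d m a x none| = 1 / 2 := by rw [bumpCoef]; norm_num
  have hb := fun b => abs_bumpCoef_some_le (d := d) (m := m) (x := x) ha b
  rw [Fintype.sum_option, Fintype.sum_option]
  simp_rw [Fintype.sum_option (f := fun j => offTerm d m a x n (some _) j)]
  simp only [offTerm, and_self, if_true, reduceCtorEq, and_false, false_and, if_false]
  rw [Finset.sum_add_distrib]
  have h1 : ∑ b : Fin d → Fin m, (if boxLag d m none - boxLag d m (some b) = n then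
      |bumpCoef d m a x none * bumpCoef d m a x (some b)| else 0) ≤ 1 / 2 * amplitude d m a := by
    refine sum_ite_eq_le_of_injective (fun b b' h => boxLag_injective (sub_right_injective h)) n
      (by positivity) fun b => ?_
    rw [abs_mul, hc]
    exact mul_le_mul_of_nonneg_left (hb b) (by norm_num)
  have h2 : ∑ b : Fin d → Fin m, (if boxLag d m (some b) - boxLag d m none = n then
      |bumpCoef d m a x (some b) * bumpCoef d m a x none| else 0) ≤ 1 / 2 * amplitude d m a := by
    refine sum_ite_eq_le_of_injective (fun b b' h => boxLag_injective (sub_left_injective h)) n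
      (by positivity) fun b => ?_
    rw [abs_mul, hc, mul_comm]
    exact mul_le_mul_of_nonneg_left (hb b) (by norm_num)
  have h3 : ∑ b : Fin d → Fin m, ∑ b' : Fin d → Fin m,
      (if boxLag d m (some b) - boxLag d m (some b') = n then
        |bumpCoef d m a x (some b) * bumpCoef d m a x (some b')| else 0) ≤ amplitude d m a := by
    have : ∀ b : Fin d → Fin m, ∑ b' : Fin d → Fin m,
      (if boxLag d m (some b) - boxLag d m (some b') = n then
        |bumpCoef d m a x (some b) * bumpCoef d m a x (some b')| else 0) ≤
          amplitude d m a * amplitude d m a := by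
      intro b
      refine sum_ite_eq_le_of_injective (fun b b' h => boxLag_injective (sub_right_injective h)) n
        (by positivity) fun b' => ?_
      rw [abs_mul]
      exact mul_le_mul (hb b) (hb b') (abs_nonneg _) hA
    refine (Finset.sum_le_sum fun b _ => this b).trans ?_
    have hcard := card_mul_amplitude (d := d) (a := a) hm
    have hq := (div_sq_le ha hm).trans ha1
    rw [Finset.sum_const, Finset.card_univ, Fintype.card_fun, Fintype.card_fin, Fintype.card_fin,
      nsmul_eq_mul, ← mul_assoc]
    push_cast
    rw [hcard]
    exact mul_le_of_le_one_left hA hq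
  linarith

/-- For a fixed row u, each pair of lags determines at most one site y, so the row sum is bounded by
the sum of coefficient products, independently of Ω. -/
theorem sum_abs_covExcess_le (ha : 0 ≤ a) (ha1 : a ≤ 1) (hm : 0 < m) (Ω : Finset (Grid d))
    (u : Grid d) : ∑ y : Ω, |covExcess d m a x (u - y.1)| ≤ 8 * (a / m ^ 2) := by
  have h1 : ∑ y : Ω, |covExcess d m a x (u - y.1)| ≤
      4 * ∑ i, ∑ j, ∑ y : Ω, offTerm d m a x (u - y.1) i j := by
    refine (Finset.sum_le_sum fun y _ => abs_covExcess_le _).trans (le_of_eq ?_)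
    rw [← Finset.mul_sum, Finset.sum_comm]
    congr 1
    exact Finset.sum_congr rfl fun i _ => Finset.sum_comm
  have h2 := sum_sum_bumpCoef_le (x := x) (d := d) ha ha1 hm zero_le_one
    (fun i j => ∑ y : Ω, offTerm d m a x (u - y.1) i j) (by simp [offTerm]) fun i j => by
      rw [mul_one]
      by_cases h : i = none ∧ j = none
      · simp only [offTerm, h, and_self, if_true, Finset.sum_const_zero, abs_nonneg]
      · simp only [offTerm, h, if_false, eq_comm (b := u - _)]
        refine sum_ite_eq_le_of_injective (g := fun y : Ω => u - y.1)
          (fun y y' h => Subtype.ext (sub_right_injective h)) _ (abs_nonneg _) fun _ => le_rfl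
  linarith

/-- In each row the sum of squares is at most the maximum, of order m^(-2-d), times the ℓ¹ norm, of
order m⁻²; this produces the exponent 4 + d of the rate. -/
theorem sum_sq_covExcess_le (ha : 0 ≤ a) (ha1 : a ≤ 1) (hm : 0 < m) (Ω : Finset (Grid d)) :
    ∑ u : Ω, ∑ y : Ω, covExcess d m a x (u.1 - y.1) ^ 2 ≤
      64 * a ^ 2 * (Ω.card / (m : ℝ) ^ (4 + d)) := by
  have hA := amplitude_nonneg (d := d) (m := m) ha
  have h : ∀ u : Ω, ∑ y : Ω, covExcess d m a x (u.1 - y.1) ^ 2 ≤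
      8 * amplitude d m a * (8 * (a / m ^ 2)) := by
    intro u
    refine le_trans ?_ (mul_le_mul_of_nonneg_left (sum_abs_covExcess_le (x := x) ha ha1 hm Ω u.1)
      (by positivity))
    rw [Finset.mul_sum]
    refine Finset.sum_le_sum fun y _ => ?_
    rw [← sq_abs, sq]
    exact mul_le_mul_of_nonneg_right (abs_covExcess_le_amplitude ha ha1 hm _) (abs_nonneg _)
  refine (Finset.sum_le_sum fun u _ => h u).trans (le_of_eq ?_)
  rw [Finset.sum_const, Finset.card_univ, Fintype.card_coe, nsmul_eq_mul, amplitude]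
  have : (m : ℝ) ≠ 0 := by exact_mod_cast hm.ne'
  field_simp
  ring

end Bounds

end SpectralEstimation

/-! ### Comparison with white noise and reduction to testing -/

namespace SpectralEstimation

variable {d m : ℕ} {a : ℝ} {x : Fin d → ℝ}

theorem movingAverageCov_neg {ι : Type*} [Fintype ι] (c : ι → ℝ) (s : ι → Grid d) (n : Grid d) :
    movingAverageCov c s (-n) = movingAverageCov c s n := by
  rw [movingAverageCov, movingAverageCov, Finset.sum_comm]
  refine Finset.sum_congr rfl fun i _ => Finset.sum_congr rfl fun j _ => ?_
  have : s j - s i = -n ↔ s i - s j = n := by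
    rw [← neg_sub, neg_inj]
  simp only [this, mul_comm (c j)]

theorem covExcess_neg (n : Grid d) : covExcess d m a x (-n) = covExcess d m a x n := by
  simp [covExcess, movingAverageCov_neg]

/-- For a = 0 only the central coefficient survives, so the reference law is white noise of variance
1/4. -/
theorem covExcess_zero (n : Grid d) : covExcess d m 0 x n = 0 := by
  have h := abs_covExcess_le (m := m) (a := 0) (x := x) n
  have h0 : ∀ i j, offTerm d m 0 x n i j = 0 := by
    intro i j
    cases i <;> cases j <;> simp [offTerm, bumpCoef, amplitude]
  simp only [h0, Finset.sum_const_zero, mul_zero] at h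
  exact abs_nonpos_iff.1 h

/-- On finitely many observations, the perturbed process is comparable to white noise. -/
theorem sq_movingAverageLaw_le (ha : 0 ≤ a) (ha1 : a ≤ 1 / 200) (hm : 0 < m)
    (x₀ : Fin d → ℝ) (Ω : Finset (Grid d)) {A : Set (Ω → ℝ)} (hA : MeasurableSet A) :
    (movingAverageLaw (bumpCoef d m a x) (boxLag d m) {X | (fun k : Ω => X k.1) ∈ A}) ^ 2 ≤
      ENNReal.ofReal (Real.exp (64 * a ^ 2 * (Ω.card / (m : ℝ) ^ (4 + d)))) *
        movingAverageLaw (bumpCoef d m 0 x₀) (boxLag d m) {X | (fun k : Ω => X k.1) ∈ A} := by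
  classical
  -- Doubling brings the reference variance 1/4 to 1, hence the covariance to the form 1 + T.
  let Y : Ω → (Grid d → ℝ) → ℝ := fun k X => 2 * X k.1
  have hYm : Measurable fun X k => Y k X := by fun_prop
  have hY : ∀ b y, HasGaussianLaw (fun X => (Y · X))
      (movingAverageLaw (bumpCoef d m b y) (boxLag d m)) := by
    intro b y
    have := ((isStationaryGaussian_movingAverageLaw (bumpCoef d m b y) (boxLag d m)).gaussian
      |>.hasGaussianLaw Ω).fun_smul 2
    exact this
  have hY0 : ∀ b y k, ∫ X, Y k X ∂movingAverageLaw (bumpCoef d m b y) (boxLag d m) = 0 := by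
    intro b y k
    simp only [Y]
    rw [integral_const_mul,
      (isStationaryGaussian_movingAverageLaw (bumpCoef d m b y) (boxLag d m)).mean_zero, mul_zero]
  have hYc : ∀ b y (k l : Ω), ∫ X, Y k X * Y l X ∂movingAverageLaw (bumpCoef d m b y) (boxLag d m) =
      (1 + Matrix.of fun u v : Ω => covExcess d m b y (u.1 - v.1)) k l := by
    intro b y k l
    have e : ∀ X : Grid d → ℝ, Y k X * Y l X = 4 * (X k.1 * X l.1) := fun X => by
      simp only [Y]; ring
    simp_rw [e]
    rw [integral_const_mul, integral_mul_movingAverageLaw, Matrix.add_apply, Matrix.one_apply,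
      Matrix.of_apply, covExcess]
    simp only [sub_eq_zero, Subtype.ext_iff]
    ring
  have hB : MeasurableSet {y : Ω → ℝ | (fun k => y k / 2) ∈ A} := by
    have hf : Measurable fun (y : Ω → ℝ) (k : Ω) => y k / 2 := by fun_prop
    exact hf hA
  have hpre : ∀ b y, (movingAverageLaw (bumpCoef d m b y) (boxLag d m)).map (fun X k => Y k X)
      {y : Ω → ℝ | (fun k => y k / 2) ∈ A} =
      movingAverageLaw (bumpCoef d m b y) (boxLag d m) {X | (fun k : Ω => X k.1) ∈ A} := by
    intro b y
    rw [Measure.map_apply hYm hB]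
    congr 1
    ext X
    simp [Y]
  have ha' : a ≤ 1 := by linarith
  have := sq_map_le_of_covariance (hY a x) (hY 0 x₀) (hY0 a x) (hY0 0 x₀)
    (T := Matrix.of fun u v : Ω => covExcess d m a x (u.1 - v.1)) ?_ ?_ (hYc a x) ?_ hB
  · rw [hpre, hpre] at this
    refine this.trans ?_
    gcongr
    exact sum_sq_covExcess_le ha ha' hm Ω
  · ext u v
    simp only [Matrix.conjTranspose_apply, Matrix.of_apply, star_trivial]
    rw [← covExcess_neg, neg_sub]
  · intro u
    simp only [Matrix.of_apply]
    refine (sum_abs_covExcess_le ha ha' hm Ω u.1).trans ?_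
    have := div_sq_le ha hm
    linarith
  · intro u v
    rw [hYc]
    simp [Matrix.add_apply, covExcess_zero]

/-- A lower bound for the minimax risk from finitely many separated hypotheses whose laws are
comparable to a common one. -/
theorem le_minimaxRisk_of_separated {Ω : Finset (Grid d)} {J : Type*} [Fintype J] [Nonempty J]
    (P : J → Measure (Grid d → ℝ)) (S : J → (Fin d → ℝ) → ℝ) (hadm : ∀ j, IsAdmissible (P j) (S j))
    (ν : Measure (Grid d → ℝ)) [IsProbabilityMeasure ν] (ξ : J → Fin d → ℝ) {δ : ℝ} (hδ : 0 ≤ δ)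
    (hsep : ∀ i j, i ≠ j → S i (ξ j) + δ ≤ S j (ξ j)) {K : ℝ}
    (hK : K ≤ Fintype.card J / 4)
    (hcmp : ∀ j (A : Set (Ω → ℝ)), MeasurableSet A →
      (P j {X | (fun k : Ω => X k.1) ∈ A}) ^ 2 ≤
        ENNReal.ofReal K * ν {X | (fun k : Ω => X k.1) ∈ A}) :
    ENNReal.ofReal (δ ^ 2 / 8) ≤ minimaxRisk Ω := by
  classical
  refine le_iInf fun E => ?_
  let r : (Grid d → ℝ) → (Ω → ℝ) := fun X k => X k.1
  have hr : Measurable r := by fun_prop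
  -- Only the finitely many test frequencies are used, which makes the event measurable without any
  -- regularity of the estimate in the frequency.
  let A : J → Set (Ω → ℝ) := fun j => ⋂ l, {y | |S j (ξ l) - E.toFun y (ξ l)| < δ / 2}
  have hA : ∀ j, MeasurableSet (A j) := fun j => MeasurableSet.iInter fun l =>
    measurableSet_lt ((measurable_const.sub (E.measurable_eval (ξ l))).abs) measurable_const
  have hdisj : Pairwise (Function.onFun Disjoint A) := by
    intro i j hij
    refine Set.disjoint_left.2 fun y hi hj => ?_
    have h1 : |S i (ξ j) - E.toFun y (ξ j)| < δ / 2 := Set.mem_iInter.1 hi j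
    have h2 : |S j (ξ j) - E.toFun y (ξ j)| < δ / 2 := Set.mem_iInter.1 hj j
    rw [abs_lt] at h1 h2
    have := hsep i j hij
    linarith
  set M : ℕ := Fintype.card J with hM
  have hM0 : (0 : ℝ) < M := by exact_mod_cast Fintype.card_pos
  have hM0' : (M : ℝ≥0∞) ≠ 0 := by exact_mod_cast Fintype.card_pos.ne'
  -- Pigeonhole: the M events are disjoint under one probability measure.
  obtain ⟨j, hj⟩ : ∃ j, ν (r ⁻¹' A j) ≤ (M : ℝ≥0∞)⁻¹ := by
    by_contra! hcon
    have h1 : ∑ j, ν (r ⁻¹' A j) ≤ 1 := by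
      rw [← tsum_fintype (L := .unconditional J), ← measure_iUnion (fun i j hij => (hdisj hij).preimage r)
        fun j => hr (hA j)]
      exact prob_le_one
    have h2 : ∑ _j : J, (M : ℝ≥0∞)⁻¹ < ∑ j, ν (r ⁻¹' A j) :=
      ENNReal.sum_lt_sum_of_nonempty Finset.univ_nonempty fun j _ => hcon j
    rw [Finset.sum_const, Finset.card_univ, nsmul_eq_mul, ← hM,
      ENNReal.mul_inv_cancel hM0' (ENNReal.natCast_ne_top _)] at h2
    exact absurd h1 (not_le.2 h2)
  have := (hadm j).process.gaussian.isProbabilityMeasure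
  have hhalf : P j (r ⁻¹' A j) ≤ ENNReal.ofReal (1 / 2) := by
    have h1 : (P j (r ⁻¹' A j)) ^ 2 ≤ (ENNReal.ofReal (1 / 2)) ^ 2 := by
      refine (hcmp j (A j) (hA j)).trans ?_
      refine (mul_le_mul' (ENNReal.ofReal_le_ofReal hK) hj).trans (le_of_eq ?_)
      rw [← ENNReal.ofReal_natCast, ← ENNReal.ofReal_inv_of_pos hM0, ← ENNReal.ofReal_pow (by norm_num),
        ← ENNReal.ofReal_mul (by positivity)]
      congr 1
      field_simp
      norm_num
    exact (ENNReal.pow_le_pow_left_iff two_ne_zero).1 h1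
  have hcompl : ENNReal.ofReal (1 / 2) ≤ P j (r ⁻¹' A j)ᶜ := by
    rw [prob_compl_eq_one_sub (hr (hA j))]
    refine le_trans ?_ (tsub_le_tsub_left hhalf 1)
    rw [← ENNReal.ofReal_one, ← ENNReal.ofReal_sub _ (by norm_num)]
    norm_num
  refine le_trans ?_ (le_iSup_of_le (P j) (le_iSup_of_le (S j) (le_iSup_of_le (hadm j) le_rfl)))
  calc ENNReal.ofReal (δ ^ 2 / 8) = ENNReal.ofReal (δ / 2) ^ 2 * ENNReal.ofReal (1 / 2) := by
        rw [← ENNReal.ofReal_pow (by positivity), ← ENNReal.ofReal_mul (by positivity)]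
        congr 1
        ring
    _ ≤ ENNReal.ofReal (δ / 2) ^ 2 * P j (r ⁻¹' A j)ᶜ := by gcongr
    _ = ∫⁻ X, (r ⁻¹' A j)ᶜ.indicator (fun _ => ENNReal.ofReal (δ / 2) ^ 2) X ∂P j := by
        rw [lintegral_indicator_const (hr (hA j)).compl]
    _ ≤ risk E (P j) (S j) := by
        refine lintegral_mono fun X => ?_
        by_cases hX : X ∈ (r ⁻¹' A j)ᶜ
        · rw [Set.indicator_of_mem hX]
          have : ∃ l, δ / 2 ≤ |S j (ξ l) - E.toFun (r X) (ξ l)| := by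
            by_contra! h
            exact hX (Set.mem_iInter.2 h)
          obtain ⟨l, hl⟩ := this
          gcongr
          exact (ENNReal.ofReal_le_ofReal hl).trans
            (le_iSup (fun ζ => ENNReal.ofReal |S j ζ - E.toFun (r X) ζ|) (ξ l))
        · rw [Set.indicator_of_notMem hX]
          exact zero_le

/-- The minimax bound at a given resolution. -/
theorem le_minimaxRisk_of_resolution (hd : 0 < d) (Ω : Finset (Grid d)) {p : ℕ} (hp : 0 < p)
    (hexp : Real.exp (64 * (1 / 200) ^ 2 * (Ω.card / ((2 * p + 1 : ℕ) : ℝ) ^ (4 + d))) ≤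
      (p : ℝ) ^ d / 4) :
    ENNReal.ofReal ((1 / 200 / (2 * ((2 * p + 1 : ℕ) : ℝ) ^ 2)) ^ 2 / 8) ≤ minimaxRisk Ω := by
  have : Nonempty (Fin d → Fin p) := ⟨fun _ => ⟨0, hp⟩⟩
  refine le_minimaxRisk_of_separated (J := Fin d → Fin p) (Ω := Ω)
    (fun j => movingAverageLaw (bumpCoef d (2 * p + 1) (1 / 200) (gridFreq j)) (boxLag d (2 * p + 1)))
    _ (fun j => isAdmissible_bump (by norm_num) le_rfl (Nat.succ_pos _))
    (movingAverageLaw (bumpCoef d (2 * p + 1) 0 0) (boxLag d (2 * p + 1)))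
    gridFreq (by positivity) (fun i j hij => ?_) (K := _) ?_
    (fun j A hA => sq_movingAverageLaw_le (by norm_num) le_rfl (Nat.succ_pos _) 0 Ω hA)
  · rw [density_gridFreq_of_ne hd _ hij]
    exact density_gridFreq_self hd _ j
  · simpa using hexp

end SpectralEstimation

/-! ### Choice of the resolution and passage to the diameter -/

namespace SpectralEstimation

variable {d : ℕ}

theorem abs_sub_le_euclideanDiam {Ω : Finset (Grid d)} {u v : Grid d} (hu : u ∈ Ω) (hv : v ∈ Ω)
    (k : Fin d) : |((u k - v k : ℤ) : ℝ)| ≤ euclideanDiam Ω := by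
  let f : Grid d → EuclideanSpace ℝ (Fin d) := fun k => WithLp.toLp 2 (fun i => (k i : ℝ))
  have hb : Bornology.IsBounded (f '' (Ω : Set (Grid d))) := (Ω.finite_toSet.image f).isBounded
  have h1 : dist (f u) (f v) ≤ euclideanDiam Ω :=
    Metric.dist_le_diam_of_mem hb ⟨u, hu, rfl⟩ ⟨v, hv, rfl⟩
  refine le_trans ?_ h1
  rw [dist_eq_norm]
  have h2 := PiLp.norm_apply_le (f u - f v) k
  simpa [f] using h2

theorem one_le_euclideanDiam {Ω : Finset (Grid d)} (h : 1 < Ω.card) : 1 ≤ euclideanDiam Ω := by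
  obtain ⟨u, hu, v, hv, huv⟩ := Finset.one_lt_card.1 h
  obtain ⟨k, hk⟩ := Function.ne_iff.1 huv
  refine le_trans ?_ (abs_sub_le_euclideanDiam hu hv k)
  have : 1 ≤ |u k - v k| := Int.one_le_abs (sub_ne_zero.2 hk)
  exact_mod_cast this

/-- A set of grid points has at most as many elements as a cube of comparable diameter. -/
theorem card_le_euclideanDiam_pow {Ω : Finset (Grid d)} (h : 1 < Ω.card) :
    (Ω.card : ℝ) ≤ (3 * euclideanDiam Ω) ^ d := by
  have hD := one_le_euclideanDiam h
  set D := euclideanDiam Ω with hDdef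
  obtain ⟨u, hu⟩ : Ω.Nonempty := Finset.card_pos.1 (by omega)
  have hF : (0 : ℤ) ≤ ⌊D⌋ := Int.floor_nonneg.2 (by linarith)
  -- Coordinate differences are integers, hence bounded by ⌊D⌋. The side 2⌊D⌋ + 1 is at most 3D
  -- because D ≥ 1.
  have hsub : Ω ⊆ Finset.Icc (fun k => u k - ⌊D⌋) (fun k => u k + ⌊D⌋) := by
    intro v hv
    have hk : ∀ k, |v k - u k| ≤ ⌊D⌋ := by
      intro k
      rw [Int.le_floor]
      exact_mod_cast abs_sub_le_euclideanDiam hv hu k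
    rw [Finset.mem_Icc]
    constructor <;> intro k <;> have := abs_le.1 (hk k) <;> simp only <;> linarith
  have hc := Finset.card_le_card hsub
  rw [Pi.card_Icc] at hc
  have e : ∀ k, (Finset.Icc (u k - ⌊D⌋) (u k + ⌊D⌋)).card = (2 * ⌊D⌋ + 1).toNat := by
    intro k
    rw [Int.card_Icc]
    congr 1
    ring
  simp only [e, Finset.prod_const, Finset.card_univ, Fintype.card_fin] at hc
  have hc' : (Ω.card : ℝ) ≤ (((2 * ⌊D⌋ + 1).toNat : ℕ) : ℝ) ^ d := by exact_mod_cast hc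
  refine hc'.trans (pow_le_pow_left₀ (Nat.cast_nonneg _) ?_ d)
  have h2 : (((2 * ⌊D⌋ + 1).toNat : ℕ) : ℝ) = 2 * (⌊D⌋ : ℝ) + 1 := by
    have : (((2 * ⌊D⌋ + 1).toNat : ℕ) : ℤ) = 2 * ⌊D⌋ + 1 := Int.toNat_of_nonneg (by omega)
    exact_mod_cast this
  rw [h2]
  have := Int.floor_le D
  linarith

/-- The constant in the minimax lower bound. -/
noncomputable def riskConst : ℝ := 1 / (1280000 * 11 ^ 4)

theorem riskConst_pos : 0 < riskConst := by unfold riskConst; norm_num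

theorem one_le_log_of_three_le {N : ℕ} (hN : 3 ≤ N) : 1 ≤ Real.log N := by
  have h3 : (3 : ℝ) ≤ N := by exact_mod_cast hN
  rw [Real.le_log_iff_exp_le (by linarith)]
  have := Real.exp_one_lt_d9
  linarith

/-- The minimax lower bound in terms of the number of observations. -/
theorem le_minimaxRisk (hd : 0 < d) (Ω : Finset (Grid d)) (hΩ : 3 ≤ Ω.card) :
    ENNReal.ofReal (riskConst * (Real.log (Ω.card : ℝ) / (Ω.card : ℝ)) ^
      ((4 : ℝ) / (4 + (d : ℝ)))) ≤ minimaxRisk Ω := by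
  have hL1 := one_le_log_of_three_le hΩ
  have hN3 : (3 : ℝ) ≤ Ω.card := by exact_mod_cast hΩ
  set N : ℝ := (Ω.card : ℝ) with hN
  set L := Real.log N with hL
  have hL0 : 0 < L := by linarith
  have hN0 : 0 < N := by linarith
  have hd1 : (1 : ℝ) ≤ d := by exact_mod_cast hd
  have hlogL : Real.log L ≤ L / 2 := by
    have h1 := Real.log_le_sub_one_of_pos (half_pos hL0)
    rw [Real.log_div hL0.ne' two_ne_zero] at h1
    have := Real.log_two_lt_d9
    linarith
  -- This is (N / log N)^(1/(4+d)), the order of the resolution m.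
  set y := Real.exp ((L - Real.log L) / (4 + d)) with hy
  have hy1 : 1 ≤ y := Real.one_le_exp (div_nonneg (by linarith) (by linarith))
  have hypow : y ^ (4 + d) = N / L := by
    rw [hy, ← Real.exp_nat_mul]
    have : ((4 + d : ℕ) : ℝ) * ((L - Real.log L) / (4 + d)) = L - Real.log L := by
      push_cast
      field_simp
    rw [this, Real.exp_sub, Real.exp_log hL0, hL, Real.exp_log hN0]
  have hratio : L / N = Real.exp (-(L - Real.log L)) := by
    rw [neg_sub, Real.exp_sub, Real.exp_log hL0, hL, Real.exp_log hN0]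
  have hrate : (L / N) ^ ((4 : ℝ) / (4 + d)) = (y ^ 4)⁻¹ := by
    rw [hratio, ← Real.exp_mul, hy, ← Real.exp_nat_mul, ← Real.exp_neg]
    congr 1
    push_cast
    ring
  -- The factor 4 absorbs the 1/4 in the testing condition, as 4^d ≥ 4. Rounding up costs at most y
  -- since y ≥ 1, whence m = 2p + 1 ≤ 11y, the source of 11⁴ in `riskConst`.
  obtain ⟨p, hp4, hp5⟩ : ∃ p : ℕ, 4 * y ≤ p ∧ (p : ℝ) ≤ 5 * y := by
    refine ⟨⌈4 * y⌉₊, Nat.le_ceil _, ?_⟩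
    have := Nat.ceil_lt_add_one (by linarith : 0 ≤ 4 * y)
    linarith
  have hp0 : (0 : ℝ) < p := by linarith
  have hm1 : y ≤ ((2 * p + 1 : ℕ) : ℝ) := by push_cast; linarith
  have hm2 : ((2 * p + 1 : ℕ) : ℝ) ≤ 11 * y := by push_cast; linarith
  refine le_trans (ENNReal.ofReal_le_ofReal ?_)
    (le_minimaxRisk_of_resolution hd Ω (by exact_mod_cast hp0) ?_)
  · rw [hrate, riskConst]
    have hmp : (0 : ℝ) < ((2 * p + 1 : ℕ) : ℝ) := by linarith
    have e : (1 / 200 / (2 * ((2 * p + 1 : ℕ) : ℝ) ^ 2)) ^ 2 / 8 =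
        1 / (1280000 * ((2 * p + 1 : ℕ) : ℝ) ^ 4) := by
      field_simp
      norm_num
    rw [e, ← one_div, one_div_mul_one_div]
    refine one_div_le_one_div_of_le (by positivity) ?_
    rw [mul_assoc, ← mul_pow]
    gcongr
  · have h1 : N / ((2 * p + 1 : ℕ) : ℝ) ^ (4 + d) ≤ L := by
      rw [div_le_iff₀ (by positivity)]
      have : y ^ (4 + d) ≤ ((2 * p + 1 : ℕ) : ℝ) ^ (4 + d) :=
        pow_le_pow_left₀ (by linarith) hm1 _
      rw [hypow, div_le_iff₀ hL0] at this
      linarith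
    have h2 : y ^ d ≤ (p : ℝ) ^ d / 4 := by
      have h3 : (4 * y) ^ d ≤ (p : ℝ) ^ d := pow_le_pow_left₀ (by linarith) hp4 _
      have h4 : (4 : ℝ) ≤ 4 ^ d := le_self_pow₀ (by norm_num) hd.ne'
      rw [mul_pow] at h3
      have : 0 ≤ y ^ d := by positivity
      nlinarith
    refine le_trans ?_ h2
    rw [hy, ← Real.exp_nat_mul]
    refine Real.exp_le_exp.2 ?_
    -- Here d/(4 + d) ≥ 1/5 and L - log L ≥ L/2. The exponent to be dominated is at most 64/200² ·
    -- L, far below L/10.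
    have h5 : (1 / 5 : ℝ) * (L / 2) ≤ d * ((L - Real.log L) / (4 + d)) := by
      rw [← mul_div_assoc (d : ℝ), le_div_iff₀ (by linarith)]
      nlinarith
    linarith

/-- In dimension zero the grid is a single point. -/
theorem dim_pos_of_one_lt_card {Ω : Finset (Grid d)} (h : 1 < Ω.card) : 0 < d := by
  rcases Nat.eq_zero_or_pos d with rfl | hd
  · have := Finset.card_le_one_of_subsingleton Ω
    omega
  · exact hd

/-- The minimax lower bound in terms of the diameter of the set of observation sites. -/
theorem le_minimaxRisk_euclideanDiam (hd : 0 < d) (Ω : Finset (Grid d)) (hΩ : 3 ≤ Ω.card) :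
    ENNReal.ofReal (riskConst / 81 * (Real.log (Ω.card : ℝ) / euclideanDiam Ω ^ d) ^
      ((4 : ℝ) / (4 + (d : ℝ)))) ≤ minimaxRisk Ω := by
  refine (ENNReal.ofReal_le_ofReal ?_).trans (le_minimaxRisk hd Ω hΩ)
  have hcard := card_le_euclideanDiam_pow (Ω := Ω) (by omega)
  have hD := one_le_euclideanDiam (Ω := Ω) (by omega)
  have hL1 := one_le_log_of_three_le hΩ
  set D := euclideanDiam Ω
  have hN0 : (0 : ℝ) < Ω.card := by exact_mod_cast (by omega : 0 < Ω.card)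
  have hDd : 0 < D ^ d := by positivity
  have hd4 : (0 : ℝ) < 4 + d := by positivity
  have h1 : Real.log (Ω.card : ℝ) / D ^ d ≤ 3 ^ d * (Real.log (Ω.card : ℝ) / Ω.card) := by
    rw [mul_pow] at hcard
    rw [mul_div_assoc', div_le_div_iff₀ hDd hN0]
    nlinarith
  -- The exponent 4d/(4 + d) stays below 4, so the loss in passing from N to the diameter is at most
  -- 3⁴, uniformly in d.
  have h2 : ((3 : ℝ) ^ d) ^ ((4 : ℝ) / (4 + d)) ≤ 81 := by
    rw [← Real.rpow_natCast, ← Real.rpow_mul (by norm_num)]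
    calc (3 : ℝ) ^ ((d : ℝ) * (4 / (4 + d))) ≤ 3 ^ (4 : ℝ) := by
          refine Real.rpow_le_rpow_of_exponent_le (by norm_num) ?_
          rw [mul_div_assoc', div_le_iff₀ hd4]
          linarith
      _ = 81 := by norm_num
  have h3 : (Real.log (Ω.card : ℝ) / D ^ d) ^ ((4 : ℝ) / (4 + d)) ≤
      81 * (Real.log (Ω.card : ℝ) / Ω.card) ^ ((4 : ℝ) / (4 + d)) := by
    refine (Real.rpow_le_rpow (by positivity) h1 (by positivity)).trans ?_
    rw [Real.mul_rpow (by positivity) (by positivity)]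
    exact mul_le_mul_of_nonneg_right h2 (by positivity)
  have := riskConst_pos
  nlinarith [mul_le_mul_of_nonneg_left h3 this.le]

end SpectralEstimation

theorem theorem2 (d : ℕ) :
    (∃ c : ℝ, 0 < c ∧ ∀ Ω : Finset (SpectralEstimation.Grid d), 3 ≤ Ω.card →
      ENNReal.ofReal (c * (Real.log (Ω.card : ℝ) / SpectralEstimation.euclideanDiam Ω ^ d) ^
          ((4 : ℝ) / (4 + (d : ℝ))))
        ≤ SpectralEstimation.minimaxRisk Ω) ∧
    (∀ C : ℝ, 0 < C → ∃ c : ℝ, 0 < c ∧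
      ∀ Ω : Finset (SpectralEstimation.Grid d), 3 ≤ Ω.card →
        SpectralEstimation.euclideanDiam Ω ≤ C * (Ω.card : ℝ) ^ ((1 : ℝ) / (d : ℝ)) →
        ENNReal.ofReal (c * (Real.log (Ω.card : ℝ) / (Ω.card : ℝ)) ^
            ((4 : ℝ) / (4 + (d : ℝ))))
          ≤ SpectralEstimation.minimaxRisk Ω) := by
  refine ⟨⟨SpectralEstimation.riskConst / 81, div_pos SpectralEstimation.riskConst_pos (by norm_num),
    fun Ω hΩ => ?_⟩, fun C _ => ⟨SpectralEstimation.riskConst, SpectralEstimation.riskConst_pos,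
    fun Ω hΩ _ => ?_⟩⟩
  · exact SpectralEstimation.le_minimaxRisk_euclideanDiam
      (SpectralEstimation.dim_pos_of_one_lt_card (Ω := Ω) (by omega)) Ω hΩ
  · exact SpectralEstimation.le_minimaxRisk
      (SpectralEstimation.dim_pos_of_one_lt_card (Ω := Ω) (by omega)) Ω hΩ
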